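/- Let $p=(p(n))_{n\ge 0}$ be a probability distribution on $\mathbb N$ with $0<p(0)<1$, $p(0)+p(1)<1$ and mean $\sum_n n\,p(n)=1$. Trees are rooted ordered trees in which every vertex has finitely many children; the set $\mathbb T$ of such trees carries the distance $d(\mathbf t,\mathbf t')=2^{-\sup\{h:\ r_h(\mathbf t)=r_h(\mathbf t')\}}$, where $r_h(\mathbf t)$ is $\mathbf t$ cut at height $h$, and its Borel $\sigma$-field. Let $\tau$ be a (critical) Galton--Watson (GW) tree with offspring distribution $p$: the number of children of the root has law $p$ and, for $n\ge1$, conditionally on the root having $n$ children, the $n$ sub-trees above them are independent and distributed as $\tau$. Let $\tau^*$ be Kesten's tree associated to $p$: the two-type GW tree whose root is special, in which a normal individual has only normal children, their number having law $p$, and a special individual has a number of children with the size-biased law $p^*(n)=n\,p(n)$, one of them, chosen uniformly, being special and the others normal. Let $L_0(\mathbf t)$ denote the number of leaves of $\mathbf t$ (vertices without children), and $|\mathbf t|$ its number of vertices. Let $p_{\{0\}}$ be the law of $\sum_{k=1}^{N-1}(X_k-1)$, where $N$ is geometric, $\mathbb P(N=n)=(1-p(0))^{n-1}p(0)$ for $n\ge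 1$, and $(X_k)_{k\ge1}$ are i.i.d., independent of $N$, with $\mathbb P(X_k=n)=p(n)/(1-p(0))$ for $n\ge1$. Let $d_{\{0\}}$ be the period of $p_{\{0\}}$, i.e. the largest $k$ such that $p_{\{0\}}(k\mathbb N)=1$. Then: (a) $p_{\{0\}}$ also satisfies $0<p_{\{0\}}(0)<1$, $p_{\{0\}}(0)+p_{\{0\}}(1)<1$ and has mean $1$, and $L_0(\tau)$ is distributed as $|\tau_{\{0\}}|$, where $\tau_{\{0\}}$ is a GW tree with offspring distribution $p_{\{0\}}$. (b) $\mathbb P(L_0(\tau)\in[n,n+d_{\{0\}}))>0$ for all large enough $n$, and if $\tau_n$ is a random tree distributed as $\tau$ conditionally on $\{L_0(\tau)\in[n,n+d_{\{0\}})\}$ (for every $n$ for which this event has positive probability), then $\tau_n\to\tau^*$ in distribution in $(\mathbb T,d)$ as $n\to\infty$. (c) $\mathbb P(L_0(\tau)\ge n)>0$ for all $n$, and if $\tau_n$ is a random tree distributed as $\tau$ conditionally on $\{L_0(\tau)\ge n\}$, then $\tau_n\to\tau^*$ in distribution in $(\mathbb T,d)$ as $n\to\infty$. -/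

import Mathlib

open MeasureTheory ProbabilityTheory Filter
open scoped ENNReal Topology

namespace RandomTree

/-! ### Ordered rooted trees -/

/-- An ordered rooted tree without infinite vertex (Neveu's formalism). Vertices are finite words;
the letters are numbered from `0`, so that the children of a vertex `u` with `k` children are
`u ++ [0], …, u ++ [k - 1]`. -/
@[ext]
structure PlaneTree where
  /-- the set of vertices -/
  nodes : Set (List ℕ)
  root_mem : [] ∈ nodes
  parent_mem : ∀ (u : List ℕ) (i : ℕ), u ++ [i] ∈ nodes → u ∈ nodes
  children : ∀ u ∈ nodes, ∃ k : ℕ, ∀ i : ℕ, u ++ [i] ∈ nodes ↔ i < k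

namespace PlaneTree

/-- The number of children of `u` in `t`. -/
noncomputable def outdegree (t : PlaneTree) (u : List ℕ) : ℕ :=
  {i : ℕ | u ++ [i] ∈ t.nodes}.ncard

/-- The set of leaves of `t`. -/
def leaves (t : PlaneTree) : Set (List ℕ) :=
  {u | u ∈ t.nodes ∧ t.outdegree u = 0}

/-- The number of leaves of `t` (possibly infinite). -/
noncomputable def numLeaves (t : PlaneTree) : ℕ∞ := t.leaves.encard

/-- The number of vertices of `t` (possibly infinite). -/
noncomputable def size (t : PlaneTree) : ℕ∞ := t.nodes.encard

/-- The sub-tree of `t` above the `i`-th child of the root. (If the root has no such child this is,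
by convention, the tree reduced to its root.) -/
def subtree (i : ℕ) (t : PlaneTree) : PlaneTree where
  nodes := {v | v = [] ∨ i :: v ∈ t.nodes}
  root_mem := Or.inl rfl
  parent_mem := by
    rintro u j (h | h)
    · simp at h
    · exact Or.inr (t.parent_mem (i :: u) j (by simpa using h))
  children := by
    intro u hu
    by_cases hi : i :: u ∈ t.nodes
    · obtain ⟨k, hk⟩ := t.children _ hi
      exact ⟨k, fun j => by simpa using hk j⟩
    · refine ⟨0, fun j => ?_⟩
      simp only [Set.mem_ofPred_eq, List.append_eq_nil_iff, List.cons_ne_self, and_false, false_or,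
        Nat.not_lt_zero, iff_false]
      exact fun h => hi (t.parent_mem (i :: u) j (by simpa using h))

/-- The restriction `r_h(t)`: the tree `t` cut at height `h`. -/
def restrict (h : ℕ) (t : PlaneTree) : PlaneTree where
  nodes := {u | u ∈ t.nodes ∧ u.length ≤ h}
  root_mem := ⟨t.root_mem, by simp⟩
  parent_mem := by
    rintro u i ⟨h1, h2⟩
    refine ⟨t.parent_mem u i h1, ?_⟩
    simp only [List.length_append, List.length_singleton] at h2
    omega
  children := by
    rintro u ⟨hu, _⟩
    by_cases hl : u.length + 1 ≤ h
    · obtain ⟨k, hk⟩ := t.children u hu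
      exact ⟨k, fun i => by simp [hk i, hl]⟩
    · exact ⟨0, fun i => by simp [hl]⟩

/-! ### The local topology -/

theorem restrict_mono {s t : PlaneTree} {h k : ℕ} (hk : k ≤ h)
    (e : restrict h s = restrict h t) : restrict k s = restrict k t := by
  have e' : ∀ u, (u ∈ s.nodes ∧ u.length ≤ h) ↔ (u ∈ t.nodes ∧ u.length ≤ h) := fun u =>
    Set.ext_iff.1 (congrArg nodes e) u
  ext u
  change (u ∈ s.nodes ∧ u.length ≤ k) ↔ (u ∈ t.nodes ∧ u.length ≤ k)
  have := e' u
  constructor <;> rintro ⟨h1, h2⟩ <;> have := h2.trans hk <;> tauto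

theorem restrict_zero (s t : PlaneTree) : restrict 0 s = restrict 0 t := by
  ext u
  change (u ∈ s.nodes ∧ u.length ≤ 0) ↔ (u ∈ t.nodes ∧ u.length ≤ 0)
  constructor
  · rintro ⟨_, h2⟩
    obtain rfl : u = [] := List.length_eq_zero_iff.1 (by omega)
    exact ⟨t.root_mem, h2⟩
  · rintro ⟨_, h2⟩
    obtain rfl : u = [] := List.length_eq_zero_iff.1 (by omega)
    exact ⟨s.root_mem, h2⟩

theorem eq_of_forall_restrict {s t : PlaneTree} (H : ∀ h, restrict h s = restrict h t) :
    s = t := by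
  ext u
  have e : (u ∈ s.nodes ∧ u.length ≤ u.length) ↔ (u ∈ t.nodes ∧ u.length ≤ u.length) :=
    Set.ext_iff.1 (congrArg nodes (H u.length)) u
  simpa using e

/-- The set of heights up to which `s` and `t` agree. -/
def agreement (s t : PlaneTree) : Set ℕ := {h | restrict h s = restrict h t}

theorem agreement_bddAbove {s t : PlaneTree} (hst : s ≠ t) : BddAbove (agreement s t) := by
  by_contra hb
  refine hst (eq_of_forall_restrict fun h => ?_)
  obtain ⟨k, hk, hlt⟩ := not_bddAbove_iff.1 hb h
  exact restrict_mono hlt.le hk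

open Classical in
/-- The distance `d(s, t) = 2 ^ (- sup {h | r_h(s) = r_h(t)})`, which is `0` if `s = t`. -/
noncomputable def treeDist (s t : PlaneTree) : ℝ :=
  if s = t then 0 else ((2 : ℝ) ^ sSup (agreement s t))⁻¹

theorem treeDist_nonneg (s t : PlaneTree) : 0 ≤ treeDist s t := by
  unfold treeDist
  split_ifs <;> positivity

theorem treeDist_le_max (s t u : PlaneTree) :
    treeDist s u ≤ max (treeDist s t) (treeDist t u) := by
  by_cases hst : s = t
  · subst hst; exact le_max_right _ _
  by_cases htu : t = u
  · subst htu; exact le_max_left _ _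
  by_cases hsu : s = u
  · have h0 : treeDist s u = 0 := by simp [treeDist, hsu]
    rw [h0]
    exact le_max_of_le_left (treeDist_nonneg _ _)
  have ha : sSup (agreement s t) ∈ agreement s t :=
    Nat.sSup_mem ⟨0, restrict_zero s t⟩ (agreement_bddAbove hst)
  have hb : sSup (agreement t u) ∈ agreement t u :=
    Nat.sSup_mem ⟨0, restrict_zero t u⟩ (agreement_bddAbove htu)
  have hc : min (sSup (agreement s t)) (sSup (agreement t u)) ≤ sSup (agreement s u) :=
    le_csSup (agreement_bddAbove hsu)
      ((restrict_mono (min_le_left _ _) ha).trans (restrict_mono (min_le_right _ _) hb))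
  have key : ∀ m : ℕ, m ≤ sSup (agreement s u) →
      ((2 : ℝ) ^ sSup (agreement s u))⁻¹ ≤ ((2 : ℝ) ^ m)⁻¹ := fun m hm =>
    inv_anti₀ (by positivity) (pow_le_pow_right₀ (by norm_num) hm)
  simp only [treeDist, hst, htu, hsu, if_false]
  rcases min_le_iff.1 hc with h | h
  · exact le_max_of_le_left (key _ h)
  · exact le_max_of_le_right (key _ h)

noncomputable instance : MetricSpace PlaneTree where
  dist := treeDist
  dist_self s := by simp [treeDist]
  dist_comm s t := by
    have h : agreement s t = agreement t s := Set.ext fun _ => eq_comm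
    by_cases hst : s = t
    · subst hst; rfl
    · simp only [treeDist, h, hst, Ne.symm hst, if_false]
  dist_triangle s t u := (treeDist_le_max s t u).trans
    (max_le_add_of_nonneg (treeDist_nonneg _ _) (treeDist_nonneg _ _))
  eq_of_dist_eq_zero {s t} h := by
    by_contra hst
    have h' : treeDist s t = 0 := h
    simp [treeDist, hst] at h'

noncomputable instance : MeasurableSpace PlaneTree := borel PlaneTree

instance : BorelSpace PlaneTree := ⟨rfl⟩

/-- The tree in which every vertex `u` has `κ u` children. -/
def ofDegrees (κ : List ℕ → ℕ) : PlaneTree where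
  nodes := {u | ∀ (v : List ℕ) (i : ℕ), v ++ [i] <+: u → i < κ v}
  root_mem := by
    intro v i h
    simp at h
  parent_mem := fun u j hu v i hv => hu v i (hv.trans (List.prefix_append u [j]))
  children := by
    intro u hu
    refine ⟨κ u, fun j => ⟨fun h => h u j (List.prefix_refl _), fun hj v i hv => ?_⟩⟩
    rcases List.prefix_concat_iff.1 hv with h | h
    · obtain ⟨rfl, hi⟩ := List.append_inj' h rfl
      obtain rfl : i = j := by simpa using hi
      exact hj
    · exact hu v i h

end PlaneTree

open PlaneTree

/-! ### Offspring distributions -/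

/-- The non-degeneracy condition `0 < p(0) < 1` and `p(0) + p(1) < 1`. -/
structure NonDegenerate (p : PMF ℕ) : Prop where
  zero_pos : 0 < p 0
  zero_lt_one : p 0 < 1
  zero_add_one_lt_one : p 0 + p 1 < 1

/-- The mean of `p`. -/
noncomputable def mean (p : PMF ℕ) : ℝ≥0∞ := ∑' n : ℕ, (n : ℝ≥0∞) * p n

/-- `p` is critical if its mean is `1`. -/
def IsCritical (p : PMF ℕ) : Prop := mean p = 1

/-- The period `max {k | P(ζ ∈ k ℕ) = 1}` of the law `p` of `ζ`. -/
noncomputable def period (p : PMF ℕ) : ℕ := sSup {k : ℕ | p.toMeasure {n : ℕ | k ∣ n} = 1}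

theorem NonDegenerate.exists_pos {p : PMF ℕ} (h : NonDegenerate p) :
    ∃ n ∈ {n : ℕ | n ≠ 0}, n ∈ p.support := by
  by_contra! H
  have h0 : ∑' n, p n = p 0 := tsum_eq_single 0 fun n hn => by
    simpa [PMF.mem_support_iff] using H n hn
  rw [p.tsum_coe] at h0
  exact h.zero_lt_one.ne h0.symm

theorem NonDegenerate.mean_ne_zero {p : PMF ℕ} (h : NonDegenerate p) : mean p ≠ 0 := by
  obtain ⟨n, hn, hp⟩ := h.exists_pos
  intro H
  have := ENNReal.tsum_eq_zero.1 H n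
  rw [mul_eq_zero, Nat.cast_eq_zero] at this
  exact this.elim hn ((PMF.mem_support_iff _ _).1 hp)

theorem IsCritical.mean_ne_top {p : PMF ℕ} (h : IsCritical p) : mean p ≠ ∞ := by
  rw [show mean p = 1 from h]
  exact ENNReal.one_ne_top

/-- The size-biased distribution `p*(n) = n p(n) / m`. -/
noncomputable def sizeBiased (p : PMF ℕ) (h : NonDegenerate p) (hm : mean p ≠ ∞) : PMF ℕ :=
  ⟨fun n => (n : ℝ≥0∞) * p n / mean p, by
    rw [ENNReal.summable.hasSum_iff]
    simp only [div_eq_mul_inv]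
    rw [ENNReal.tsum_mul_right]
    exact ENNReal.mul_inv_cancel h.mean_ne_zero hm⟩

/-! ### Galton–Watson trees -/

section GaltonWatson

variable {Ω : Type*} [MeasurableSpace Ω]

/-- The branching property: for `n ≥ 1`, conditionally on the root having `n` children, the `n`
sub-trees above the children of the root are independent and distributed as the whole tree. -/
def HasBranchingProperty (τ : Ω → PlaneTree) (P : Measure Ω) : Prop :=
  ∀ n : ℕ, 1 ≤ n → P {ω | (τ ω).outdegree [] = n} ≠ 0 →
    iIndepFun (fun (i : Fin n) (ω : Ω) => subtree i (τ ω)) (P[|{ω | (τ ω).outdegree [] = n}]) ∧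
    ∀ i : Fin n,
      HasLaw (fun ω => subtree i (τ ω)) (P.map τ) (P[|{ω | (τ ω).outdegree [] = n}])

/-- `τ` is, under the probability measure `P`, a Galton–Watson tree with offspring
distribution `p`. -/
structure IsGaltonWatsonTree (p : PMF ℕ) (τ : Ω → PlaneTree) (P : Measure Ω) : Prop where
  measurable : Measurable τ
  branching : HasBranchingProperty τ P
  root_law : ∀ n : ℕ, P {ω | (τ ω).outdegree [] = n} = p n

end GaltonWatson

/-! ### Kesten's tree -/

/-- The law of the pair (number of children, rank of the special child) for a special individual:
the number `k` of children has the size-biased law, hence `k ≥ 1` almost surely, and given `k` the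
rank of the special child is uniform on `{0, …, k - 1}`. -/
noncomputable def specialLaw (p : PMF ℕ) (h : NonDegenerate p) (hm : mean p ≠ ∞) : PMF (ℕ × ℕ) :=
  (sizeBiased p h hm).bind fun k =>
    (PMF.uniformOfFinset (Finset.range (k - 1 + 1)) (by simp)).map fun j => (k, j)

/-- Independent data attached to each word `u`: the number of children of `u` if `u` is a normal
individual (law `p`), and, independently, the number of children of `u` together with the rank of
its special child if `u` is a special individual (law `specialLaw`). -/
noncomputable def kestenData (p : PMF ℕ) (h : NonDegenerate p) (hm : mean p ≠ ∞) :
    Measure (List ℕ → ℕ × (ℕ × ℕ)) :=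
  Measure.infinitePi fun _ => p.toMeasure.prod (specialLaw p h hm).toMeasure

/-- The special individual of generation `n`: the root is special, and the unique special child of
a special individual `u` is the one whose rank is given by the data at `u`. -/
def specialNode (ω : List ℕ → ℕ × (ℕ × ℕ)) : ℕ → List ℕ
  | 0 => []
  | n + 1 => specialNode ω n ++ [(ω (specialNode ω n)).2.2]

open Classical in
/-- The two-type tree built from the data `ω`, special and normal individuals reproducing each
according to their own rule. -/
noncomputable def kestenOf (ω : List ℕ → ℕ × (ℕ × ℕ)) : PlaneTree :=
  ofDegrees fun u => if ∃ n, u = specialNode ω n then (ω u).2.1 else (ω u).1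

/-- The law of Kesten's tree associated to `p`. -/
noncomputable def kestenLaw (p : PMF ℕ) (h : NonDegenerate p) (hm : mean p ≠ ∞) :
    Measure PlaneTree :=
  (kestenData p h hm).map kestenOf

/-! ### The offspring distribution of the tree of leaves -/

/-- The law of the sum of `n` independent random variables with law `q`. -/
noncomputable def sumLaw (q : PMF ℕ) : ℕ → PMF ℕ
  | 0 => PMF.pure 0
  | n + 1 => (sumLaw q n).bind fun s => q.map fun x => s + x

/-- The geometric law `P(N - 1 = n) = (1 - p(0)) ^ n * p(0)`, `n ≥ 0`. -/
noncomputable def geometricLaw (p : PMF ℕ) (h : NonDegenerate p) : PMF ℕ :=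
  ⟨fun n => (1 - p 0) ^ n * p 0, by
    rw [ENNReal.summable.hasSum_iff, ENNReal.tsum_mul_right, ENNReal.tsum_geometric,
      ENNReal.sub_sub_cancel ENNReal.one_ne_top h.zero_lt_one.le]
    exact ENNReal.inv_mul_cancel h.zero_pos.ne' (PMF.apply_ne_top p 0)⟩

/-- The law `p_{0}` of `∑_{k=1}^{N-1} (X_k - 1)`, where `N` is geometric with parameter `p(0)` and
the `X_k` are independent, independent of `N`, with the law `p` conditioned on being positive.
It is the law of the number of sub-trees attached to the left-most branch of a Galton–Watson tree
with offspring distribution `p`. -/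
noncomputable def leafOffspring (p : PMF ℕ) (h : NonDegenerate p) : PMF ℕ :=
  (geometricLaw p h).bind
    (sumLaw ((p.filter {n : ℕ | n ≠ 0} h.exists_pos).map fun x => x - 1))

end RandomTree

open RandomTree RandomTree.PlaneTree

/-!
Decompose a tree along its left-most branch, which ends at a leaf: the generating function `G` of
the number of leaves satisfies `G(x) = x ψ(G(x))`, where `ψ` is the generating function of `p_{0}`.
This is the equation satisfied by the number of vertices of a Galton–Watson tree with offspring
distribution `p_{0}`, and by criticality it has only one solution with values in `[0, 1]`.

By the hitting time theorem, the total progeny `v` of a Galton–Watson tree with offspring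
distribution `q` is given by `n v(n) = P(S_n = n - 1)`, where `S` is the random walk with step law
`q`. Given that `S_n = n - 1`, the number of steps equal to a given `e` concentrates around
`n q(e)`, because `P(S_n = n - 1)` does not decay exponentially. Removing one such step from the
walk then shows that the ratio `v(n + d) / v(n)` tends to `1` along the lattice carrying `v`.

If `τ` coincides with `t` up to height `h`, then `L₀(τ) = ℓ + L₀(τ_1) + ⋯ + L₀(τ_k)`, where `ℓ` is
the number of leaves of `t` below height `h` and `τ_1, …, τ_k` are independent copies of `τ`, one
for each of the `k` vertices of `t` at height `h`. Any one of these `k` terms can be the large one,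
the others being of order `1`. Hence, conditionally on `L₀(τ)` being large, the probability that `τ`
coincides with `t` up to height `h` is asymptotically at least `k` times the unconditional one, and
this product is the probability for Kesten's tree. An open set of trees is a countable disjoint
union of such balls, so these lower bounds and the portmanteau theorem give the convergence in
distribution.
-/

namespace RandomTree

open scoped Asymptotics

/-! ### Generating functions -/

theorem tsum_eq_zero_add_tsum_succ (f : ℕ → ℝ≥0∞) : ∑' n, f n = f 0 + ∑' n, f (n + 1) :=
  tsum_eq_zero_add' ENNReal.summable

theorem tsum_mul_pow_eq_zero_add (a : ℕ → ℝ≥0∞) (x : ℝ≥0∞) :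
    ∑' n, a n * x ^ n = a 0 + x * ∑' n, a (n + 1) * x ^ n := by
  rw [tsum_eq_zero_add_tsum_succ, pow_zero, mul_one, ← ENNReal.tsum_mul_left]
  exact congrArg _ (tsum_congr fun n => by ring)

theorem tsum_succ_ne_top {a : ℕ → ℝ≥0∞} (ha : ∑' n, a n ≠ ∞) : ∑' n, a (n + 1) ≠ ∞ :=
  ne_top_of_le_ne_top ha <| ENNReal.tsum_comp_le_tsum_of_injective (add_left_injective 1) a

theorem tendsto_tsum_mul_pow {a : ℕ → ℝ≥0∞} (ha : ∑' n, a n ≠ ∞) :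
    Tendsto (fun x : ℝ≥0∞ => ∑' n, a n * x ^ n) (𝓝[>] 0) (𝓝 (a 0)) := by
  have hlim : Tendsto (fun x : ℝ≥0∞ => a 0 + x * ∑' n, a (n + 1)) (𝓝[>] 0) (𝓝 (a 0)) := by
    have := (ENNReal.Tendsto.mul_const (tendsto_id (x := 𝓝 (0 : ℝ≥0∞)))
      (Or.inr (tsum_succ_ne_top ha))).const_add (a 0)
    simpa using this.mono_left (nhdsWithin_le_nhds (s := Set.Ioi 0))
  refine tendsto_of_tendsto_of_tendsto_of_le_of_le' tendsto_const_nhds hlim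
    (Eventually.of_forall fun x => (tsum_mul_pow_eq_zero_add a x).symm ▸ le_self_add) ?_
  filter_upwards [Ioo_mem_nhdsGT (zero_lt_one' ℝ≥0∞)] with x hx
  rw [tsum_mul_pow_eq_zero_add]
  gcongr with n
  exact mul_le_of_le_one_right' (pow_le_one' hx.2.le n)

theorem coeff_eq_of_eventually_tsum_mul_pow_eq {a b : ℕ → ℝ≥0∞} (ha : ∑' n, a n ≠ ∞)
    (hb : ∑' n, b n ≠ ∞) (h : ∀ᶠ x in 𝓝[>] 0, ∑' n, a n * x ^ n = ∑' n, b n * x ^ n) (n : ℕ) :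
    a n = b n := by
  have hzero : a 0 = b 0 :=
    tendsto_nhds_unique ((tendsto_tsum_mul_pow ha).congr' h) (tendsto_tsum_mul_pow hb)
  induction n generalizing a b with
  | zero => exact hzero
  | succ _ ih =>
    have htail : ∀ᶠ x in 𝓝[>] 0, ∑' k, a (k + 1) * x ^ k = ∑' k, b (k + 1) * x ^ k := by
      filter_upwards [h, Ioo_mem_nhdsGT (zero_lt_one' ℝ≥0∞)] with x hx hx01
      rw [tsum_mul_pow_eq_zero_add, tsum_mul_pow_eq_zero_add b, hzero] at hx
      have hb0 : b 0 ≠ ∞ := ne_top_of_le_ne_top hb (ENNReal.le_tsum 0)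
      exact (ENNReal.mul_right_inj hx01.1.ne' hx01.2.ne_top).1 ((ENNReal.add_right_inj hb0).1 hx)
    have ha' := tsum_succ_ne_top ha
    have hb' := tsum_succ_ne_top hb
    exact ih ha' hb' htail <|
      tendsto_nhds_unique ((tendsto_tsum_mul_pow ha').congr' htail) (tendsto_tsum_mul_pow hb')

theorem coeff_eq_of_tsum_mul_pow_eq {a b : ℕ → ℝ≥0∞} (ha : ∑' n, a n ≠ ∞) (hb : ∑' n, b n ≠ ∞)
    (h : ∀ x < 1, ∑' n, a n * x ^ n = ∑' n, b n * x ^ n) (n : ℕ) : a n = b n := by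
  refine coeff_eq_of_eventually_tsum_mul_pow_eq ha hb ?_ n
  filter_upwards [Ioo_mem_nhdsGT (zero_lt_one' ℝ≥0∞)] with x hx using h x hx.2

theorem tsum_bind_mul {α β : Type*} (q : PMF α) (f : α → PMF β) (g : β → ℝ≥0∞) :
    ∑' b, q.bind f b * g b = ∑' a, q a * ∑' b, f a b * g b := by
  simp only [PMF.bind_apply, ← ENNReal.tsum_mul_right, ← ENNReal.tsum_mul_left]
  rw [ENNReal.tsum_comm]
  simp only [mul_assoc]

theorem tsum_pure_mul {β : Type*} (b : β) (g : β → ℝ≥0∞) : ∑' c, PMF.pure b c * g c = g b := by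
  rw [tsum_eq_single b fun c hc => by simp [hc]]
  simp

theorem tsum_map_mul {α β : Type*} (q : PMF α) (f : α → β) (g : β → ℝ≥0∞) :
    ∑' b, q.map f b * g b = ∑' a, q a * g (f a) := by
  rw [PMF.map, tsum_bind_mul]
  simp only [Function.comp, tsum_pure_mul]

theorem tsum_sumLaw_succ_mul (q : PMF ℕ) (n : ℕ) (g : ℕ → ℝ≥0∞) :
    ∑' m, sumLaw q (n + 1) m * g m = ∑' s, sumLaw q n s * ∑' k, q k * g (s + k) := by
  rw [sumLaw, tsum_bind_mul]
  simp only [tsum_map_mul]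

/-- The probability generating function of `q`. It takes values in `[0, ∞]`, so that its series
always has a sum. -/
noncomputable def pgf (q : PMF ℕ) (x : ℝ≥0∞) : ℝ≥0∞ := ∑' n, q n * x ^ n

theorem eq_of_pgf_eq {q r : PMF ℕ} (h : ∀ x < 1, pgf q x = pgf r x) : q = r :=
  PMF.ext (coeff_eq_of_tsum_mul_pow_eq q.tsum_coe_ne_top r.tsum_coe_ne_top h)

theorem pgf_bind {α : Type*} (q : PMF α) (f : α → PMF ℕ) (x : ℝ≥0∞) :
    pgf (q.bind f) x = ∑' a, q a * pgf (f a) x := tsum_bind_mul q f _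

theorem pgf_map_succ (q : PMF ℕ) (x : ℝ≥0∞) : pgf (q.map (· + 1)) x = x * pgf q x := by
  rw [pgf, tsum_map_mul, pgf, ← ENNReal.tsum_mul_left]
  exact tsum_congr fun n => by ring

theorem pgf_sumLaw (q : PMF ℕ) (n : ℕ) (x : ℝ≥0∞) : pgf (sumLaw q n) x = pgf q x ^ n := by
  induction n with
  | zero => rw [pgf, sumLaw, tsum_pure_mul, pow_zero, pow_zero]
  | succ n ih =>
    have hshift : ∀ s : ℕ, ∑' k, q k * x ^ (s + k) = x ^ s * pgf q x := fun s => by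
      rw [pgf, ← ENNReal.tsum_mul_left]
      exact tsum_congr fun k => by ring
    rw [pgf, tsum_sumLaw_succ_mul, pow_succ, ← ih, pgf, ← ENNReal.tsum_mul_right]
    simp only [hshift, mul_assoc]

theorem pgf_le_one (q : PMF ℕ) {x : ℝ≥0∞} (hx : x ≤ 1) : pgf q x ≤ 1 := by
  rw [← q.tsum_coe]
  exact ENNReal.tsum_le_tsum fun n => mul_le_of_le_one_right' (pow_le_one' hx n)

theorem pgf_ne_top (q : PMF ℕ) {x : ℝ≥0∞} (hx : x ≤ 1) : pgf q x ≠ ∞ :=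
  ne_top_of_le_ne_top ENNReal.one_ne_top (pgf_le_one q hx)

theorem pgf_one (q : PMF ℕ) : pgf q 1 = 1 := by simp only [pgf, one_pow, mul_one, q.tsum_coe]

theorem apply_zero_le_pgf (q : PMF ℕ) (x : ℝ≥0∞) : q 0 ≤ pgf q x := by
  rw [pgf, tsum_mul_pow_eq_zero_add]
  exact le_self_add

theorem mean_eq_tsum_mul (q : PMF ℕ) : mean q = ∑' n, q n * (n : ℝ≥0∞) :=
  tsum_congr fun _ => mul_comm _ _

theorem mean_bind {α : Type*} (q : PMF α) (f : α → PMF ℕ) :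
    mean (q.bind f) = ∑' a, q a * mean (f a) := by
  simp only [mean_eq_tsum_mul]
  exact tsum_bind_mul q f _

theorem tsum_mul_add_natCast (q : PMF ℕ) (s : ℝ≥0∞) : ∑' n, q n * (s + n) = s + mean q := by
  simp only [mul_add, ENNReal.tsum_add, ENNReal.tsum_mul_right, q.tsum_coe, one_mul,
    mean_eq_tsum_mul]

theorem mean_map_succ (q : PMF ℕ) : mean (q.map (· + 1)) = mean q + 1 := by
  rw [mean_eq_tsum_mul, tsum_map_mul, add_comm, ← tsum_mul_add_natCast]
  exact tsum_congr fun n => by push_cast; ring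

theorem mean_sumLaw (q : PMF ℕ) (n : ℕ) : mean (sumLaw q n) = n * mean q := by
  induction n with
  | zero => simp only [mean_eq_tsum_mul, sumLaw, tsum_pure_mul, Nat.cast_zero, zero_mul]
  | succ n ih =>
    rw [mean_eq_tsum_mul, tsum_sumLaw_succ_mul]
    simp only [Nat.cast_add, tsum_mul_add_natCast]
    simp only [mul_add, ENNReal.tsum_add, ENNReal.tsum_mul_right, PMF.tsum_coe, one_mul]
    rw [← mean_eq_tsum_mul, ih, Nat.cast_one, add_mul, one_mul]

theorem mean_bind_sumLaw (q r : PMF ℕ) : mean (q.bind (sumLaw r)) = mean q * mean r := by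
  simp only [mean_bind, mean_sumLaw, ← mul_assoc]
  rw [ENNReal.tsum_mul_right, ← mean_eq_tsum_mul]

theorem apply_zero_add_apply_one_add_tsum (q : PMF ℕ) : q 0 + q 1 + ∑' n, q (n + 2) = 1 := by
  rw [← q.tsum_coe, tsum_eq_zero_add_tsum_succ q, tsum_eq_zero_add_tsum_succ fun n => q (n + 1),
    add_assoc]

theorem apply_zero_add_apply_one_lt_one_iff {q : PMF ℕ} :
    q 0 + q 1 < 1 ↔ ∃ n, q (n + 2) ≠ 0 := by
  have hsum := apply_zero_add_apply_one_add_tsum q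
  constructor
  · intro hlt
    by_contra! h
    rw [ENNReal.tsum_eq_zero.2 h, add_zero] at hsum
    exact hlt.ne hsum
  · intro h
    have htail : ∑' n, q (n + 2) ≠ 0 := by simpa [ENNReal.tsum_eq_zero] using h
    have hne : q 0 + q 1 ≠ ∞ := ENNReal.add_ne_top.2 ⟨q.apply_ne_top 0, q.apply_ne_top 1⟩
    rw [← hsum]
    exact ENNReal.lt_add_right hne htail

/-! ### The offspring distribution of the tree of leaves -/

section LeafOffspring

variable {p : PMF ℕ}

/-- The law of `X - 1`, for `X` with the law `p` conditioned on being positive: the number of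
siblings of a child on the left-most branch. -/
noncomputable def excessLaw (p : PMF ℕ) (h : NonDegenerate p) : PMF ℕ :=
  (p.filter {n : ℕ | n ≠ 0} h.exists_pos).map fun x => x - 1

theorem tsum_apply_succ (p : PMF ℕ) : ∑' n, p (n + 1) = 1 - p 0 := by
  refine ENNReal.eq_sub_of_add_eq' ENNReal.one_ne_top ?_
  rw [add_comm, ← tsum_eq_zero_add_tsum_succ p, p.tsum_coe]

theorem one_sub_mul_excessLaw_apply (h : NonDegenerate p) (n : ℕ) :
    (1 - p 0) * excessLaw p h n = p (n + 1) := by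
  have hne : 1 - p 0 ≠ 0 := (tsub_pos_of_lt h.zero_lt_one).ne'
  have hsum : ∑' n, ({n : ℕ | n ≠ 0} : Set ℕ).indicator p n = 1 - p 0 := by
    rw [tsum_eq_zero_add_tsum_succ, ← tsum_apply_succ]
    simp
  have happly : excessLaw p h n = p (n + 1) * (1 - p 0)⁻¹ := by
    rw [excessLaw, PMF.map_apply, tsum_eq_single (n + 1)]
    · simp only [add_tsub_cancel_right, if_true, PMF.filter_apply, hsum]
      simp
    · rintro (_ | m) hm
      · simp
      · simp only [add_tsub_cancel_right, ite_eq_right_iff]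
        omega
  rw [happly, mul_left_comm, ENNReal.mul_inv_cancel hne (ENNReal.sub_ne_top ENNReal.one_ne_top),
    mul_one]

theorem mul_pgf_excessLaw_add (h : NonDegenerate p) (s : ℝ≥0∞) :
    p 0 + s * ((1 - p 0) * pgf (excessLaw p h) s) = pgf p s := by
  rw [pgf, pgf, tsum_mul_pow_eq_zero_add p, ← ENNReal.tsum_mul_left]
  simp only [← mul_assoc, one_sub_mul_excessLaw_apply]

theorem one_sub_mul_mean_excessLaw (h : NonDegenerate p) (hc : IsCritical p) :
    (1 - p 0) * mean (excessLaw p h) = p 0 := by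
  have hb : 1 - p 0 ≠ ∞ := ENNReal.sub_ne_top ENNReal.one_ne_top
  have hsum : p 0 + (1 - p 0) = 1 := add_tsub_cancel_of_le h.zero_lt_one.le
  have hmean : (1 - p 0) * mean (excessLaw p h) + (1 - p 0) = 1 := by
    rw [mean_eq_tsum_mul, ← tsum_apply_succ p, ← ENNReal.tsum_mul_left, ← ENNReal.tsum_add,
      ← show mean p = 1 from hc, mean_eq_tsum_mul, tsum_eq_zero_add_tsum_succ fun n => p n * n]
    simp only [tsum_apply_succ, ← mul_assoc, one_sub_mul_excessLaw_apply]
    simp [mul_add]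
  exact (ENNReal.add_left_inj hb).1 (hmean.trans hsum.symm)

theorem tsum_natCast_mul_pow {x : ℝ≥0∞} (hx : x < 1) :
    ∑' n : ℕ, (n : ℝ≥0∞) * x ^ n = x / (1 - x) ^ 2 := by
  lift x to NNReal using hx.ne_top
  have hx1 : (x : ℝ) < 1 := by exact_mod_cast hx
  have hS := hasSum_coe_mul_geometric_of_norm_lt_one (r := (x : ℝ)) (by simpa using hx1)
  have hterm (n : ℕ) : (n : ℝ≥0∞) * (x : ℝ≥0∞) ^ n = ENNReal.ofReal (n * (x : ℝ) ^ n) := by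
    rw [ENNReal.ofReal_mul n.cast_nonneg, ENNReal.ofReal_natCast,
      ENNReal.ofReal_pow NNReal.zero_le_coe, ENNReal.ofReal_coe_nnreal]
  simp only [hterm]
  rw [← ENNReal.ofReal_tsum_of_nonneg (fun n => by positivity) hS.summable, hS.tsum_eq,
    ENNReal.ofReal_div_of_pos (by nlinarith), ENNReal.ofReal_pow (by linarith),
    ENNReal.ofReal_sub _ NNReal.zero_le_coe, ENNReal.ofReal_one, ENNReal.ofReal_coe_nnreal]

theorem mean_geometricLaw (h : NonDegenerate p) : mean (geometricLaw p h) = (1 - p 0) / p 0 := by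
  have hsub : 1 - (1 - p 0) = p 0 := ENNReal.sub_sub_cancel ENNReal.one_ne_top h.zero_lt_one.le
  have hlt : 1 - p 0 < 1 := ENNReal.sub_lt_self ENNReal.one_ne_top one_ne_zero h.zero_pos.ne'
  calc mean (geometricLaw p h) = ∑' n : ℕ, (n : ℝ≥0∞) * ((1 - p 0) ^ n * p 0) := rfl
    _ = (1 - p 0) / p 0 ^ 2 * p 0 := by
      simp only [← mul_assoc]
      rw [ENNReal.tsum_mul_right, tsum_natCast_mul_pow hlt, hsub]
    _ = (1 - p 0) / p 0 := by
      rw [sq, div_eq_mul_inv, ENNReal.mul_inv (Or.inl h.zero_pos.ne') (Or.inl (p.apply_ne_top 0)),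
        mul_assoc, mul_assoc, ENNReal.inv_mul_cancel h.zero_pos.ne' (p.apply_ne_top 0), mul_one,
        div_eq_mul_inv]

theorem isCritical_leafOffspring (h : NonDegenerate p) (hc : IsCritical p) :
    IsCritical (leafOffspring p h) := by
  calc mean (leafOffspring p h) = mean (geometricLaw p h) * mean (excessLaw p h) :=
      mean_bind_sumLaw _ _
    _ = (1 - p 0) * mean (excessLaw p h) / p 0 := by
      rw [mean_geometricLaw, ENNReal.mul_div_right_comm]
    _ = 1 := by
      rw [one_sub_mul_mean_excessLaw h hc, ENNReal.div_self h.zero_pos.ne' (p.apply_ne_top 0)]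

theorem IsCritical.nonDegenerate {q : PMF ℕ} (hc : IsCritical q) (h0 : 0 < q 0) :
    NonDegenerate q := by
  suffices hlt : q 0 + q 1 < 1 from ⟨h0, le_self_add.trans_lt hlt, hlt⟩
  rw [apply_zero_add_apply_one_lt_one_iff]
  by_contra! h
  have hmean : mean q = q 1 := by
    rw [mean, tsum_eq_single 1, Nat.cast_one, one_mul]
    rintro (_ | _ | n) hn
    · simp
    · exact absurd rfl hn
    · rw [h n, mul_zero]
  have hsum := apply_zero_add_apply_one_add_tsum q
  rw [← hmean, show mean q = 1 from hc, ENNReal.tsum_eq_zero.2 h, add_zero] at hsum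
  exact (ENNReal.lt_add_right ENNReal.one_ne_top h0.ne').ne' (by rwa [add_comm] at hsum)

theorem nonDegenerate_leafOffspring (h : NonDegenerate p) (hc : IsCritical p) :
    NonDegenerate (leafOffspring p h) := by
  refine (isCritical_leafOffspring h hc).nonDegenerate ?_
  rw [pos_iff_ne_zero, ← PMF.mem_support_iff, leafOffspring, PMF.mem_support_bind_iff]
  have hgeom : geometricLaw p h 0 = p 0 := (congrArg (· * p 0) (pow_zero _)).trans (one_mul _)
  exact ⟨0, (PMF.mem_support_iff _ _).2 (hgeom ▸ h.zero_pos.ne'), by simp [sumLaw]⟩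

theorem pgf_leafOffspring_eq_add (h : NonDegenerate p) (s : ℝ≥0∞) :
    pgf (leafOffspring p h) s =
      p 0 + (1 - p 0) * pgf (excessLaw p h) s * pgf (leafOffspring p h) s := by
  have hgeom : pgf (leafOffspring p h) s =
      ∑' n, p 0 * ((1 - p 0) * pgf (excessLaw p h) s) ^ n := by
    refine (pgf_bind (geometricLaw p h) (sumLaw (excessLaw p h)) s).trans <|
      tsum_congr fun n => ?_
    rw [pgf_sumLaw, mul_pow]
    change (1 - p 0) ^ n * p 0 * _ = _
    ring
  rw [hgeom]
  exact tsum_mul_pow_eq_zero_add (fun _ => p 0) _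

theorem pgf_leafOffspring_mul_add (h : NonDegenerate p) (s : ℝ≥0∞) :
    pgf (leafOffspring p h) s * (s + p 0) = p 0 * s + pgf (leafOffspring p h) s * pgf p s := by
  set ψ := pgf (leafOffspring p h) s
  set χ := (1 - p 0) * pgf (excessLaw p h) s
  have hψ : ψ = p 0 + χ * ψ := pgf_leafOffspring_eq_add h s
  calc ψ * (s + p 0) = (p 0 + χ * ψ) * s + ψ * p 0 := by rw [← hψ, mul_add]
    _ = p 0 * s + ψ * (p 0 + s * χ) := by ring
    _ = p 0 * s + ψ * pgf p s := by rw [mul_pgf_excessLaw_add]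

end LeafOffspring

/-! ### Strict convexity of the generating function -/

section Convexity

variable {s u : ℝ≥0∞}

theorem add_pow_le_pow_add_mul (h : s + u ≤ 1) (n : ℕ) : (s + u) ^ n ≤ s ^ n + n * u := by
  induction n with
  | zero => simp
  | succ n ih =>
    calc (s + u) ^ (n + 1) = s * (s + u) ^ n + (s + u) ^ n * u := by ring
      _ ≤ s * (s ^ n + n * u) + 1 * u := by gcongr; exact pow_le_one' h n
      _ ≤ s * s ^ n + 1 * (n * u) + 1 * u := by
        rw [mul_add]
        gcongr
        exact le_self_add.trans h
      _ = s ^ (n + 1) + (n + 1 : ℕ) * u := by push_cast; ring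

theorem add_pow_lt_pow_add_mul (hu : u ≠ 0) (h : s + u ≤ 1) (n : ℕ) :
    (s + u) ^ (n + 2) < s ^ (n + 2) + (n + 2 : ℕ) * u := by
  have hu_top : u ≠ ∞ := ne_top_of_le_ne_top ENNReal.one_ne_top (le_add_self.trans h)
  have hs_top : s ≠ ∞ := ne_top_of_le_ne_top ENNReal.one_ne_top (le_self_add.trans h)
  have hs1 : s < 1 := (ENNReal.lt_add_right hs_top hu).trans_le h
  have hnu : s * ((n + 1 : ℕ) * u) < 1 * ((n + 1 : ℕ) * u) :=
    (ENNReal.mul_lt_mul_iff_left (mul_ne_zero (by simp) hu)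
      (ENNReal.mul_ne_top (ENNReal.natCast_ne_top _) hu_top)).2 hs1
  calc (s + u) ^ (n + 2) = s * (s + u) ^ (n + 1) + (s + u) ^ (n + 1) * u := by ring
    _ ≤ s * (s ^ (n + 1) + (n + 1 : ℕ) * u) + 1 * u := by
      gcongr
      exacts [add_pow_le_pow_add_mul h _, pow_le_one' h _]
    _ = s ^ (n + 2) + u + s * ((n + 1 : ℕ) * u) := by ring
    _ < s ^ (n + 2) + u + 1 * ((n + 1 : ℕ) * u) :=
      ENNReal.add_lt_add_left (ENNReal.add_ne_top.2 ⟨ENNReal.pow_ne_top hs_top, hu_top⟩) hnu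
    _ = s ^ (n + 2) + (n + 2 : ℕ) * u := by push_cast; ring

theorem pgf_add_lt {p : PMF ℕ} (hp : p 0 + p 1 < 1) (hu : u ≠ 0)
    (h : s + u ≤ 1) : pgf p (s + u) < pgf p s + mean p * u := by
  have hsum : pgf p s + mean p * u = ∑' n, p n * (s ^ n + n * u) := by
    simp only [mul_add, ENNReal.tsum_add, ← mul_assoc, ENNReal.tsum_mul_right, mean_eq_tsum_mul,
      pgf]
  obtain ⟨n, hn⟩ := apply_zero_add_apply_one_lt_one_iff.1 hp
  rw [hsum]
  exact ENNReal.tsum_lt_tsum (pgf_ne_top p h)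
    (fun k => mul_le_mul_right (add_pow_le_pow_add_mul h k) _)
    ((ENNReal.mul_lt_mul_iff_right hn (p.apply_ne_top _)).2 (add_pow_lt_pow_add_mul hu h n))

theorem le_of_add_eq_pgf_add {p : PMF ℕ} (hp : NonDegenerate p) (hc : IsCritical p)
    {s t a b : ℝ≥0∞} (ht : t ≤ 1) (hb : b ≠ ∞)
    (es : s + a = pgf p s + b) (et : t + a = pgf p t + b) : t ≤ s := by
  by_contra! hst
  obtain ⟨u, hu, rfl⟩ : ∃ u, u ≠ 0 ∧ t = s + u :=
    ⟨t - s, (tsub_pos_of_lt hst).ne', (add_tsub_cancel_of_le hst.le).symm⟩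
  have hlt := pgf_add_lt hp.zero_add_one_lt_one hu ht
  rw [show mean p = 1 from hc, one_mul] at hlt
  refine (ENNReal.add_lt_add_right hb hlt).ne ?_
  calc pgf p (s + u) + b = s + a + u := by rw [← et]; ring
    _ = pgf p s + u + b := by rw [es]; ring

theorem eq_of_add_eq_pgf_add {p : PMF ℕ} (hp : NonDegenerate p) (hc : IsCritical p)
    {s t a b : ℝ≥0∞} (hs : s ≤ 1) (ht : t ≤ 1) (hb : b ≠ ∞)
    (es : s + a = pgf p s + b) (et : t + a = pgf p t + b) : s = t :=
  le_antisymm (le_of_add_eq_pgf_add hp hc hs hb et es)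
    (le_of_add_eq_pgf_add hp hc ht hb es et)

end Convexity

/-! ### Random walks with non-negative steps -/

section PowerSeries

open Finset.HasAntidiagonal

theorem coeff_X_mul_derivative {R : Type*} [CommSemiring R] (f : PowerSeries R) (n : ℕ) :
    (PowerSeries.X * PowerSeries.derivative R f).coeff n = n * f.coeff n := by
  rcases n with _ | n
  · simp
  · rw [PowerSeries.coeff_succ_X_mul, PowerSeries.coeff_derivative, mul_comm, Nat.cast_succ]

variable {R : Type*} [Semiring R] [PartialOrder R] [IsOrderedRing R] {f : PowerSeries R}

theorem coeff_pow_nonneg (h0 : ∀ i, 0 ≤ f.coeff i) (n s : ℕ) : 0 ≤ (f ^ n).coeff s := by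
  induction n generalizing s with
  | zero => rw [pow_zero, PowerSeries.coeff_one]; split_ifs <;> simp
  | succ n ih =>
    rw [pow_succ, PowerSeries.coeff_mul]
    exact Finset.sum_nonneg fun x _ => mul_nonneg (ih _) (h0 _)

theorem coeff_pow_le {B : R} (h0 : ∀ i, 0 ≤ f.coeff i)
    (hB : ∀ s, ∑ i ∈ Finset.range s, f.coeff i ≤ B) (n s : ℕ) : (f ^ n).coeff s ≤ B ^ n := by
  have hB0 : 0 ≤ B := by simpa using hB 0
  induction n generalizing s with
  | zero => rw [pow_zero, PowerSeries.coeff_one]; split_ifs <;> simp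
  | succ n ih =>
    rw [pow_succ', PowerSeries.coeff_mul]
    calc ∑ x ∈ antidiagonal s, f.coeff x.1 * (f ^ n).coeff x.2
        ≤ ∑ x ∈ antidiagonal s, f.coeff x.1 * B ^ n :=
          Finset.sum_le_sum fun x _ => mul_le_mul_of_nonneg_left (ih _) (h0 _)
      _ = (∑ i ∈ Finset.range (s + 1), f.coeff i) * B ^ n := by
          rw [← Finset.sum_mul, Finset.Nat.sum_antidiagonal_eq_sum_range_succ
            (fun a _ => f.coeff a)]
      _ ≤ B * B ^ n := mul_le_mul_of_nonneg_right (hB _) (pow_nonneg hB0 n)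
      _ = B ^ (n + 1) := (pow_succ' B n).symm

end PowerSeries

section WalkProb

open Finset.HasAntidiagonal

/-- The generating function of `q` as a formal power series. -/
noncomputable def genSeries (q : PMF ℕ) : PowerSeries ℝ := PowerSeries.mk fun n => (q n).toReal

/-- The probability that the sum of `n` independent variables with law `q` is `s`, encoded as a
coefficient of the `n`-th power of the generating function. -/
noncomputable def walkProb (q : PMF ℕ) (n s : ℕ) : ℝ := (genSeries q ^ n).coeff s

variable (q : PMF ℕ)

theorem coeff_genSeries (n : ℕ) : (genSeries q).coeff n = (q n).toReal := PowerSeries.coeff_mk _ _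

theorem walkProb_zero (s : ℕ) : walkProb q 0 s = if s = 0 then 1 else 0 := by
  rw [walkProb, pow_zero, PowerSeries.coeff_one]

theorem walkProb_one (s : ℕ) : walkProb q 1 s = (q s).toReal := by
  rw [walkProb, pow_one, coeff_genSeries]

theorem walkProb_succ (n s : ℕ) :
    walkProb q (n + 1) s = ∑ x ∈ antidiagonal s, (q x.1).toReal * walkProb q n x.2 := by
  simp only [walkProb, pow_succ', PowerSeries.coeff_mul, coeff_genSeries]

theorem walkProb_nonneg (n s : ℕ) : 0 ≤ walkProb q n s :=
  coeff_pow_nonneg (fun i => coeff_genSeries q i ▸ ENNReal.toReal_nonneg) n s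

theorem walkProb_mul_le (m n s t : ℕ) :
    walkProb q m s * walkProb q n t ≤ walkProb q (m + n) (s + t) := by
  rw [walkProb.eq_1 q (m + n), pow_add, PowerSeries.coeff_mul]
  exact Finset.single_le_sum (f := fun x : ℕ × ℕ => walkProb q m x.1 * walkProb q n x.2)
    (fun x _ => mul_nonneg (walkProb_nonneg q m x.1) (walkProb_nonneg q n x.2))
    (mem_antidiagonal.2 rfl : (s, t) ∈ antidiagonal (s + t))

theorem walkProb_pow_le (n s k : ℕ) : walkProb q n s ^ k ≤ walkProb q (k * n) (k * s) := by
  induction k with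
  | zero => simp [walkProb_zero]
  | succ k ih =>
    rw [pow_succ, Nat.succ_mul, Nat.succ_mul]
    exact (mul_le_mul_of_nonneg_right ih (walkProb_nonneg q n s)).trans (walkProb_mul_le q _ _ _ _)

/-- By exchangeability, the mean of one step given that `n + 1` steps add up to `s` is
`s / (n + 1)`. -/
theorem sum_mul_walkProb (n s : ℕ) :
    (n + 1) * ∑ x ∈ antidiagonal s, x.1 * (q x.1).toReal * walkProb q n x.2 =
      s * walkProb q (n + 1) s := by
  have hderiv : PowerSeries.X * PowerSeries.derivative ℝ (genSeries q ^ (n + 1)) =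
      PowerSeries.C ((n : ℝ) + 1) *
        (PowerSeries.X * PowerSeries.derivative ℝ (genSeries q) * genSeries q ^ n) := by
    rw [PowerSeries.derivative_pow, Nat.add_sub_cancel, map_add, map_natCast, map_one]
    push_cast
    ring
  rw [walkProb, ← coeff_X_mul_derivative, hderiv, PowerSeries.coeff_C_mul, PowerSeries.coeff_mul]
  simp only [coeff_X_mul_derivative, coeff_genSeries, walkProb]

end WalkProb

/-! ### Concentration of the number of steps of a given size -/

section StepCount

theorem sum_toReal_le_one {α : Type*} (q : PMF α) (s : Finset α) : ∑ i ∈ s, (q i).toReal ≤ 1 := by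
  rw [← ENNReal.toReal_sum fun i _ => q.apply_ne_top i, ← ENNReal.toReal_one]
  exact ENNReal.toReal_mono ENNReal.one_ne_top (q.tsum_coe ▸ ENNReal.sum_le_tsum s)

/-- The generating function of the restriction of `q` to the complement of `{e}`. -/
noncomputable def restSeries (q : PMF ℕ) (e : ℕ) : PowerSeries ℝ :=
  PowerSeries.mk fun n => if n = e then 0 else (q n).toReal

/-- The probability that `n` independent steps with law `q` add up to `s` and that exactly `j` of
them are equal to `e`. -/
noncomputable def stepCountProb (q : PMF ℕ) (e n s j : ℕ) : ℝ :=
  n.choose j * (q e).toReal ^ j * (PowerSeries.X ^ (e * j) * restSeries q e ^ (n - j)).coeff s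

variable (q : PMF ℕ) (e n s : ℕ)

theorem coeff_restSeries_nonneg (i : ℕ) : 0 ≤ (restSeries q e).coeff i := by
  rw [restSeries, PowerSeries.coeff_mk]
  split_ifs <;> simp

theorem coeff_C_mul_X_pow_add_restSeries (y : ℝ) (i : ℕ) :
    (PowerSeries.C (y * (q e).toReal) * PowerSeries.X ^ e + restSeries q e).coeff i =
      if i = e then y * (q e).toReal else (q i).toReal := by
  rw [map_add, PowerSeries.coeff_C_mul, PowerSeries.coeff_X_pow, restSeries, PowerSeries.coeff_mk]
  split_ifs <;> simp

theorem stepCountProb_nonneg (j : ℕ) : 0 ≤ stepCountProb q e n s j := by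
  refine mul_nonneg (by positivity) ?_
  rw [PowerSeries.coeff_X_pow_mul']
  split_ifs
  · exact coeff_pow_nonneg (coeff_restSeries_nonneg q e) _ _
  · exact le_rfl

theorem sum_stepCountProb_mul_pow (y : ℝ) :
    ∑ j ∈ Finset.range (n + 1), stepCountProb q e n s j * y ^ j =
      ((PowerSeries.C (y * (q e).toReal) * PowerSeries.X ^ e + restSeries q e) ^ n).coeff s := by
  rw [add_pow, map_sum]
  refine Finset.sum_congr rfl fun j _ => ?_
  have hterm : (PowerSeries.C (y * (q e).toReal) * PowerSeries.X ^ e) ^ j *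
      restSeries q e ^ (n - j) * (n.choose j : PowerSeries ℝ) =
        PowerSeries.C ((n.choose j : ℝ) * (y * (q e).toReal) ^ j) *
          (PowerSeries.X ^ (e * j) * restSeries q e ^ (n - j)) := by
    rw [map_mul PowerSeries.C (_ : ℝ) (_ ^ j), map_pow, map_natCast, pow_mul]
    ring
  rw [hterm, PowerSeries.coeff_C_mul, stepCountProb]
  ring

theorem sum_stepCountProb :
    ∑ j ∈ Finset.range (n + 1), stepCountProb q e n s j = walkProb q n s := by
  have hsplit :
      PowerSeries.C (1 * (q e).toReal) * PowerSeries.X ^ e + restSeries q e = genSeries q := by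
    ext i
    rw [coeff_C_mul_X_pow_add_restSeries, coeff_genSeries]
    split_ifs with h <;> simp [h]
  rw [walkProb, ← hsplit, ← sum_stepCountProb_mul_pow]
  simp only [one_pow, mul_one]

theorem sum_stepCountProb_mul_pow_le {y : ℝ} (hy : 0 ≤ y) :
    ∑ j ∈ Finset.range (n + 1), stepCountProb q e n s j * y ^ j ≤
      (1 + (q e).toReal * (y - 1)) ^ n := by
  rw [sum_stepCountProb_mul_pow]
  refine coeff_pow_le (fun i => ?_) (fun N => ?_) n s
  · rw [coeff_C_mul_X_pow_add_restSeries]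
    split_ifs <;> positivity
  · have hle : ∑ i ∈ Finset.range N, (if i = e then y * (q e).toReal else (q i).toReal) ≤
        ∑ i ∈ insert e (Finset.range N), (if i = e then y * (q e).toReal else (q i).toReal) :=
      Finset.sum_le_sum_of_subset_of_nonneg (Finset.subset_insert _ _) fun i _ _ => by
        split_ifs <;> positivity
    have hsum := sum_toReal_le_one q (insert e (Finset.range N))
    rw [← Finset.add_sum_erase _ _ (Finset.mem_insert_self _ _)] at hle hsum
    rw [if_pos rfl, Finset.sum_congr rfl fun i hi => if_neg (Finset.ne_of_mem_erase hi)] at hle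
    simp only [coeff_C_mul_X_pow_add_restSeries]
    linarith

theorem sum_mul_stepCountProb :
    ∑ j ∈ Finset.range (n + 1 + 1), (j : ℝ) * stepCountProb q e (n + 1) (s + e) j =
      (n + 1) * (q e).toReal * walkProb q n s := by
  rw [Finset.sum_range_succ', ← sum_stepCountProb q e, Finset.mul_sum]
  simp only [Nat.cast_zero, zero_mul, add_zero]
  refine Finset.sum_congr rfl fun j _ => ?_
  have hchoose : ((n + 1).choose (j + 1) : ℝ) * (j + 1) = (n + 1) * n.choose j := by
    exact_mod_cast (Nat.add_one_mul_choose_eq n j).symm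
  have hcoeff :
      (PowerSeries.X ^ (e * (j + 1)) * restSeries q e ^ (n + 1 - (j + 1))).coeff (s + e) =
        (PowerSeries.X ^ (e * j) * restSeries q e ^ (n - j)).coeff s := by
    rw [mul_add, mul_one, pow_add, mul_right_comm, Nat.add_sub_add_right,
      PowerSeries.coeff_mul_X_pow]
  rw [stepCountProb, stepCountProb, hcoeff]
  push_cast
  linear_combination ((q e).toReal ^ (j + 1) *
    (PowerSeries.X ^ (e * j) * restSeries q e ^ (n - j)).coeff s) * hchoose

theorem sum_sub_mul_stepCountProb :
    ∑ j ∈ Finset.range (n + 1 + 1),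
        ((j : ℝ) - (q e).toReal * (n + 1)) * stepCountProb q e (n + 1) (s + e) j =
      (n + 1) * ((q e).toReal * (walkProb q n s - walkProb q (n + 1) (s + e))) := by
  simp only [sub_mul]
  rw [Finset.sum_sub_distrib, ← Finset.mul_sum, sum_stepCountProb, sum_mul_stepCountProb]
  ring

end StepCount

theorem exp_tilt_le {α δ x : ℝ} (hα : 0 ≤ α) (hα1 : α ≤ 1) (hδ1 : δ ≤ 1) (hx : |x| = δ / 2) :
    Real.exp (-(x * α + δ ^ 2 / 2)) * (1 + α * (Real.exp x - 1)) ≤ Real.exp (-(δ ^ 2 / 4)) := by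
  have hexp : Real.exp x - 1 ≤ x + δ ^ 2 / 4 := by
    have habs := (abs_le.1 (Real.abs_exp_sub_one_sub_id_le (x := x) (by rw [hx]; linarith))).2
    have hsq : x ^ 2 = δ ^ 2 / 4 := by rw [← sq_abs, hx]; ring
    linarith
  have htilt : 1 + α * (Real.exp x - 1) ≤ Real.exp (x * α + δ ^ 2 / 4) := by
    refine le_trans ?_ (Real.add_one_le_exp _)
    have := mul_le_mul_of_nonneg_left hexp hα
    have := mul_le_mul_of_nonneg_right hα1 (show 0 ≤ δ ^ 2 / 4 by positivity)
    linarith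
  calc _ ≤ Real.exp (-(x * α + δ ^ 2 / 2)) * Real.exp (x * α + δ ^ 2 / 4) :=
        mul_le_mul_of_nonneg_left htilt (Real.exp_pos _).le
    _ = _ := by rw [← Real.exp_add]; ring_nf

theorem abs_le_add_mul_exp {y N θ D : ℝ} (hy : |y| ≤ N) (hθ : 0 ≤ θ) (hD : 0 ≤ D) :
    |y| ≤ D + N * Real.exp (θ * y - θ * D) + N * Real.exp (-θ * y - θ * D) := by
  have hN : 0 ≤ N := (abs_nonneg y).trans hy
  have hpos := mul_nonneg hN (Real.exp_pos (θ * y - θ * D)).le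
  have hneg := mul_nonneg hN (Real.exp_pos (-θ * y - θ * D)).le
  rcases le_or_gt |y| D with h | h
  · linarith
  have htail : N ≤ N * Real.exp (θ * |y| - θ * D) :=
    le_mul_of_one_le_right hN (Real.one_le_exp (sub_nonneg.2 (mul_le_mul_of_nonneg_left h.le hθ)))
  rcases abs_cases y with ⟨habs, _⟩ | ⟨habs, _⟩
  · rw [habs] at htail hy ⊢
    linarith
  · rw [habs, mul_neg, ← neg_mul] at htail
    linarith

section Concentration

variable (q : PMF ℕ) (e n s : ℕ) {δ : ℝ}

/-- Chernoff's bound for the number of steps equal to `e`. -/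
theorem sum_stepCountProb_mul_exp_le (hδ1 : δ ≤ 1) {x : ℝ} (hx : |x| = δ / 2) :
    ∑ j ∈ Finset.range (n + 1), stepCountProb q e n s j *
        Real.exp (x * (j - (q e).toReal * n) - δ / 2 * (δ * n)) ≤
      Real.exp (-(δ ^ 2 / 4)) ^ n := by
  set α := (q e).toReal
  have hα0 : 0 ≤ α := ENNReal.toReal_nonneg
  have hα1 : α ≤ 1 := by simpa using sum_toReal_le_one q {e}
  have hbase : 0 ≤ 1 + α * (Real.exp x - 1) := by
    have := mul_nonneg hα0 (Real.exp_pos x).le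
    linarith
  calc _ = Real.exp (-(x * α + δ ^ 2 / 2)) ^ n *
        ∑ j ∈ Finset.range (n + 1), stepCountProb q e n s j * Real.exp x ^ j := by
        rw [Finset.mul_sum]
        refine Finset.sum_congr rfl fun j _ => ?_
        rw [← Real.exp_nat_mul, ← Real.exp_nat_mul, mul_left_comm (Real.exp _), ← Real.exp_add]
        ring_nf
    _ ≤ Real.exp (-(x * α + δ ^ 2 / 2)) ^ n * (1 + α * (Real.exp x - 1)) ^ n :=
        mul_le_mul_of_nonneg_left (sum_stepCountProb_mul_pow_le q e n s (Real.exp_pos x).le)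
          (by positivity)
    _ = (Real.exp (-(x * α + δ ^ 2 / 2)) * (1 + α * (Real.exp x - 1))) ^ n := (mul_pow _ _ _).symm
    _ ≤ _ := pow_le_pow_left₀ (mul_nonneg (Real.exp_pos _).le hbase)
        (exp_tilt_le hα0 hα1 hδ1 hx) _

theorem sum_abs_sub_mul_stepCountProb_le (hδ : 0 < δ) (hδ1 : δ ≤ 1) :
    ∑ j ∈ Finset.range (n + 1), |(j : ℝ) - (q e).toReal * n| * stepCountProb q e n s j ≤
      n * (δ * walkProb q n s + 2 * Real.exp (-(δ ^ 2 / 4)) ^ n) := by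
  set α := (q e).toReal
  have hα0 : 0 ≤ α := ENNReal.toReal_nonneg
  have hα1 : α ≤ 1 := by simpa using sum_toReal_le_one q {e}
  have habs : |δ / 2| = δ / 2 := abs_of_pos (half_pos hδ)
  have hdev (j : ℕ) (hj : j ∈ Finset.range (n + 1)) : |(j : ℝ) - α * n| ≤ n := by
    have hjn : (j : ℝ) ≤ n := by exact_mod_cast Nat.lt_succ_iff.1 (Finset.mem_range.1 hj)
    have hαn : α * n ≤ n := mul_le_of_le_one_left n.cast_nonneg hα1
    have hαn0 : 0 ≤ α * n := mul_nonneg hα0 n.cast_nonneg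
    exact abs_le.2 ⟨by linarith, by linarith⟩
  calc _ ≤ ∑ j ∈ Finset.range (n + 1), (δ * n * stepCountProb q e n s j +
        n * (stepCountProb q e n s j * Real.exp (δ / 2 * (j - α * n) - δ / 2 * (δ * n))) +
        n * (stepCountProb q e n s j *
          Real.exp (-(δ / 2) * (j - α * n) - δ / 2 * (δ * n)))) := by
        refine Finset.sum_le_sum fun j hj => ?_
        refine (mul_le_mul_of_nonneg_right (abs_le_add_mul_exp (hdev j hj) (half_pos hδ).le
          (mul_nonneg hδ.le n.cast_nonneg)) (stepCountProb_nonneg q e n s j)).trans_eq ?_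
        ring
    _ = δ * n * walkProb q n s + n * _ + n * _ := by
        rw [Finset.sum_add_distrib, Finset.sum_add_distrib, ← Finset.mul_sum, ← Finset.mul_sum,
          ← Finset.mul_sum, sum_stepCountProb]
    _ ≤ δ * n * walkProb q n s + n * Real.exp (-(δ ^ 2 / 4)) ^ n +
        n * Real.exp (-(δ ^ 2 / 4)) ^ n := by
        gcongr
        · exact sum_stepCountProb_mul_exp_le q e n s hδ1 habs
        · exact sum_stepCountProb_mul_exp_le q e n s hδ1 (by rw [abs_neg, habs])
    _ = _ := by ring

theorem toReal_mul_abs_walkProb_sub_le (hδ : 0 < δ) (hδ1 : δ ≤ 1) :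
    (q e).toReal * |walkProb q n s - walkProb q (n + 1) (s + e)| ≤
      δ * walkProb q (n + 1) (s + e) + 2 * Real.exp (-(δ ^ 2 / 4)) ^ (n + 1) := by
  have hpos : (0 : ℝ) < n + 1 := by positivity
  refine le_of_mul_le_mul_left ?_ hpos
  calc _ = |∑ j ∈ Finset.range (n + 1 + 1),
        ((j : ℝ) - (q e).toReal * (n + 1)) * stepCountProb q e (n + 1) (s + e) j| := by
        rw [sum_sub_mul_stepCountProb, abs_mul, abs_of_pos hpos, abs_mul,
          abs_of_nonneg ENNReal.toReal_nonneg]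
    _ ≤ ∑ j ∈ Finset.range (n + 1 + 1),
        |(j : ℝ) - (q e).toReal * (n + 1)| * stepCountProb q e (n + 1) (s + e) j := by
        refine (Finset.abs_sum_le_sum_abs _ _).trans_eq (Finset.sum_congr rfl fun j _ => ?_)
        rw [abs_mul, abs_of_nonneg (stepCountProb_nonneg q e (n + 1) (s + e) j)]
    _ ≤ _ := by
        simpa only [Nat.cast_add, Nat.cast_one] using
          sum_abs_sub_mul_stepCountProb_le q e (n + 1) (s + e) hδ hδ1

end Concentration

section RatioLimit

variable {ι : Type*} {l : Filter ι} {n : ι → ℕ}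

/-- `w` decays slower than any exponential in `n`. -/
def SubexponentialDecay (l : Filter ι) (n : ι → ℕ) (w : ι → ℝ) : Prop :=
  ∀ r : ℝ, 0 < r → r < 1 → ∃ C > 0, ∀ᶠ t in l, C * r ^ n t ≤ w t

theorem SubexponentialDecay.pow_isLittleO {w : ι → ℝ} (hw : SubexponentialDecay l n w)
    (hn : Tendsto n l atTop) {ρ : ℝ} (hρ0 : 0 ≤ ρ) (hρ1 : ρ < 1) :
    (fun t => ρ ^ n t) =o[l] w := by
  obtain ⟨r, hρr, hr1⟩ := exists_between hρ1
  have hr0 : 0 < r := hρ0.trans_lt hρr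
  obtain ⟨C, hC, hev⟩ := hw r hr0 hr1
  have hbig : (fun t => r ^ n t) =O[l] w := by
    refine Asymptotics.IsBigO.of_bound C⁻¹ ?_
    filter_upwards [hev] with t ht
    rw [Real.norm_of_nonneg (by positivity), inv_mul_eq_div, le_div_iff₀' hC]
    exact ht.trans (le_abs_self _)
  exact ((isLittleO_pow_pow_of_lt_left hρ0 hρr).comp_tendsto hn).trans_isBigO hbig

theorem walkProb_isEquivalent {q : PMF ℕ} {e : ℕ} (he : q e ≠ 0) {s : ι → ℕ}
    (hn : Tendsto n l atTop)
    (hsub : SubexponentialDecay l n fun t => walkProb q (n t + 1) (s t + e)) :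
    (fun t => walkProb q (n t) (s t)) ~[l] fun t => walkProb q (n t + 1) (s t + e) := by
  rw [Asymptotics.IsEquivalent, Asymptotics.isLittleO_iff]
  intro ε hε
  have hα : 0 < (q e).toReal := ENNReal.toReal_pos he (q.apply_ne_top e)
  set α := (q e).toReal
  obtain ⟨δ, hδ, hδ1, hδε⟩ : ∃ δ : ℝ, 0 < δ ∧ δ ≤ 1 ∧ δ ≤ α * ε / 2 :=
    ⟨min 1 (α * ε / 2), by positivity, min_le_left _ _, min_le_right _ _⟩
  set ρ := Real.exp (-(δ ^ 2 / 4))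
  have hρ0 : 0 ≤ ρ := Real.exp_nonneg _
  have hρ1 : ρ < 1 := Real.exp_lt_one_iff.2 (neg_lt_zero.2 (by positivity))
  filter_upwards [(hsub.pow_isLittleO hn hρ0 hρ1).def (show 0 < α * ε / 4 by positivity)] with t ht
  have hle := toReal_mul_abs_walkProb_sub_le q e (n t) (s t) hδ hδ1
  have hpow : ρ ^ (n t + 1) ≤ ρ ^ n t := pow_le_pow_of_le_one hρ0 hρ1.le (Nat.le_succ _)
  rw [Real.norm_of_nonneg (by positivity), Real.norm_of_nonneg (walkProb_nonneg _ _ _)] at ht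
  rw [Pi.sub_apply, Real.norm_eq_abs, Real.norm_of_nonneg (walkProb_nonneg _ _ _)]
  have hδw := mul_le_mul_of_nonneg_right hδε (walkProb_nonneg q (n t + 1) (s t + e))
  refine le_of_mul_le_mul_left ?_ hα
  linarith

end RatioLimit

/-! ### The diagonal of the random walk -/

section Period

variable {q : PMF ℕ}

theorem setGcd_support_pos (h : NonDegenerate q) : 0 < Nat.setGcd q.support := by
  obtain ⟨n, hn, hq⟩ := h.exists_pos
  exact Nat.pos_of_ne_zero fun H => hn (Nat.setGcd_eq_zero_iff.1 H hq)

theorem period_eq_setGcd (h : NonDegenerate q) : period q = Nat.setGcd q.support := by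
  have hset : {k : ℕ | q.toMeasure {n : ℕ | k ∣ n} = 1} = {k | k ∣ Nat.setGcd q.support} := by
    ext k
    rw [Set.mem_ofPred_eq, PMF.toMeasure_apply_eq_one_iff _ MeasurableSet.of_discrete,
      Set.mem_ofPred_eq, Nat.dvd_setGcd_iff]
    rfl
  have hgreatest : IsGreatest {k | k ∣ Nat.setGcd q.support} (Nat.setGcd q.support) :=
    ⟨dvd_rfl, fun _ hk => Nat.le_of_dvd (setGcd_support_pos h) hk⟩
  rw [period, hset, hgreatest.csSup_eq]

theorem period_pos (h : NonDegenerate q) : 0 < period q :=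
  period_eq_setGcd h ▸ setGcd_support_pos h

theorem period_dvd (h : NonDegenerate q) {n : ℕ} (hn : q n ≠ 0) : period q ∣ n := by
  rw [period_eq_setGcd h]
  exact Nat.setGcd_dvd_of_mem ((PMF.mem_support_iff _ _).2 hn)

theorem period_dvd_of_mem_closure (h : NonDegenerate q) {n : ℕ}
    (hn : n ∈ AddSubmonoid.closure q.support) : period q ∣ n :=
  period_eq_setGcd h ▸ Nat.setGcd_dvd_of_mem_closure hn

theorem exists_forall_mem_closure_support (h : NonDegenerate q) :
    ∃ m, ∀ n ≥ m, period q ∣ n → n ∈ AddSubmonoid.closure q.support := by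
  rw [period_eq_setGcd h]
  exact Nat.exists_mem_closure_of_ge q.support

theorem walkProb_eq_zero_of_not_dvd (h : NonDegenerate q) {n s : ℕ}
    (hs : ¬ period q ∣ s) : walkProb q n s = 0 := by
  induction n generalizing s with
  | zero => rw [walkProb_zero, if_neg (by rintro rfl; exact hs (dvd_zero _))]
  | succ n ih =>
    rw [walkProb_succ]
    refine Finset.sum_eq_zero fun x hx => ?_
    rw [← Finset.HasAntidiagonal.mem_antidiagonal.1 hx] at hs
    by_cases hx1 : q x.1 = 0
    · rw [hx1, ENNReal.toReal_zero, zero_mul]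
    · rw [ih fun hd => hs (dvd_add (period_dvd h hx1) hd), mul_zero]

end Period

section Diagonal

variable {q : PMF ℕ}

theorem toReal_pos_of_ne_zero {n : ℕ} (h : q n ≠ 0) : 0 < (q n).toReal :=
  ENNReal.toReal_pos h (q.apply_ne_top n)

theorem pow_mul_walkProb_le (q : PMF ℕ) (n s i : ℕ) :
    (q 0).toReal ^ i * walkProb q n s ≤ walkProb q (n + i) s := by
  calc (q 0).toReal ^ i * walkProb q n s = walkProb q n s * walkProb q 1 0 ^ i := by
        rw [walkProb_one, mul_comm]
    _ ≤ walkProb q n s * walkProb q (i * 1) (i * 0) :=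
        mul_le_mul_of_nonneg_left (walkProb_pow_le q 1 0 i) (walkProb_nonneg q n s)
    _ ≤ walkProb q (n + i) s := by
        simpa only [mul_one, mul_zero, add_zero] using walkProb_mul_le q n (i * 1) s (i * 0)

theorem walkProb_self_pos_of_mem_closure (h0 : q 0 ≠ 0) {n : ℕ}
    (hn : n ∈ AddSubmonoid.closure q.support) : 0 < walkProb q n n := by
  induction hn using AddSubmonoid.closure_induction with
  | mem e he =>
    rcases e with _ | e
    · simp [walkProb_zero]
    · have hpow := pow_mul_walkProb_le q 1 (e + 1) e
      rw [walkProb_one, add_comm 1 e] at hpow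
      exact (mul_pos (pow_pos (toReal_pos_of_ne_zero h0) e)
        (toReal_pos_of_ne_zero ((PMF.mem_support_iff _ _).1 he))).trans_le hpow
  | zero => simp [walkProb_zero]
  | add a b _ _ ha hb => exact (mul_pos ha hb).trans_le (walkProb_mul_le q a b a b)

theorem exists_forall_walkProb_self_pos (h : NonDegenerate q) :
    ∃ m, ∀ n ≥ m, period q ∣ n → 0 < walkProb q n n := by
  obtain ⟨m, hm⟩ := exists_forall_mem_closure_support h
  exact ⟨m, fun n hn hd => walkProb_self_pos_of_mem_closure h.zero_pos.ne' (hm n hn hd)⟩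

theorem exists_forall_mul_pow_le_walkProb_self (h : NonDegenerate q) {r : ℝ} (hr0 : 0 < r)
    (hr1 : r < 1) {k : ℕ} (hk : 0 < k) (hrk : r ^ k ≤ walkProb q k k) :
    ∃ C > 0, ∃ m, ∀ n ≥ m, period q ∣ n → C * r ^ n ≤ walkProb q n n := by
  obtain ⟨m, hm⟩ := exists_forall_walkProb_self_pos h
  have hkd : period q ∣ k := by
    by_contra H
    rw [walkProb_eq_zero_of_not_dvd h H] at hrk
    exact (pow_pos hr0 k).not_ge hrk
  obtain ⟨C, hCm, hC⟩ : ∃ C, (∀ i ∈ {i ∈ Finset.Ico m (m + k) | period q ∣ i},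
      C < walkProb q i i) ∧ 0 < C := by
    refine (((Filter.eventually_all_finset _).2 fun i hi => ?_).and
      (self_mem_nhdsWithin (a := (0 : ℝ)) (s := Set.Ioi 0))).exists
    rw [Finset.mem_filter, Finset.mem_Ico] at hi
    exact nhdsWithin_le_nhds (gt_mem_nhds (hm i hi.1.1 hi.2))
  refine ⟨C, hC, m, fun n hn hd => ?_⟩
  obtain ⟨i, j, hmi, hik, rfl⟩ : ∃ i j, m ≤ i ∧ i < m + k ∧ n = j * k + i := by
    refine ⟨m + (n - m) % k, (n - m) / k, by omega, by have := Nat.mod_lt (n - m) hk; omega, ?_⟩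
    have := Nat.div_add_mod' (n - m) k
    omega
  have hid : period q ∣ i := (Nat.dvd_add_right (hkd.mul_left j)).1 hd
  have hCi : C ≤ walkProb q i i :=
    (hCm i (Finset.mem_filter.2 ⟨Finset.mem_Ico.2 ⟨hmi, hik⟩, hid⟩)).le
  calc C * r ^ (j * k + i) = (r ^ k) ^ j * C * r ^ i := by ring
    _ ≤ (r ^ k) ^ j * C := mul_le_of_le_one_right (by positivity) (pow_le_one₀ hr0.le hr1.le)
    _ ≤ walkProb q (j * k) (j * k) * walkProb q i i :=
        mul_le_mul ((pow_le_pow_left₀ (by positivity) hrk j).trans (walkProb_pow_le q k k j)) hCi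
          hC.le (walkProb_nonneg _ _ _)
    _ ≤ walkProb q (j * k + i) (j * k + i) := walkProb_mul_le q (j * k) i (j * k) i

theorem walkProb_succ_mul_le (q : PMF ℕ) (m e : ℕ) :
    walkProb q (m + 1) m * ((q 0).toReal ^ e * (q (e + 2)).toReal) ≤
      walkProb q (m + (e + 2)) (m + (e + 2)) := by
  calc _ = (q 0).toReal ^ e * (walkProb q (m + 1) m * walkProb q 1 (e + 2)) := by
        rw [walkProb_one]; ring
    _ ≤ (q 0).toReal ^ e * walkProb q (m + 1 + 1) (m + (e + 2)) :=
        mul_le_mul_of_nonneg_left (walkProb_mul_le _ _ _ _ _) (by positivity)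
    _ ≤ walkProb q (m + 1 + 1 + e) (m + (e + 2)) := pow_mul_walkProb_le q _ _ e
    _ = _ := by rw [show m + 1 + 1 + e = m + (e + 2) by ring]

end Diagonal

/-! ### The total progeny -/

section TotalProgeny

open Finset.HasAntidiagonal

theorem sumLaw_one (v : PMF ℕ) : sumLaw v 1 = v :=
  eq_of_pgf_eq fun x _ => by rw [pgf_sumLaw, pow_one]

theorem map_succ_apply_zero {α : Type*} (q : PMF α) (f : α → ℕ) :
    q.map (fun a => f a + 1) 0 = 0 := by
  rw [PMF.map_apply]
  exact ENNReal.tsum_eq_zero.2 fun m => if_neg (by omega)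

theorem map_succ_apply_succ (q : PMF ℕ) (n : ℕ) : q.map (· + 1) (n + 1) = q n := by
  rw [PMF.map_apply, tsum_eq_single n, if_pos rfl]
  exact fun m hm => if_neg (by omega)

/-- `v` is the law of the total progeny of a Galton–Watson tree with offspring distribution `q`.
This law is characterized by the functional equation of its generating function. -/
def IsTotalProgeny (q v : PMF ℕ) : Prop := ∀ x < 1, pgf v x = x * pgf q (pgf v x)

namespace IsTotalProgeny

variable {q v : PMF ℕ}

/-- In a forest of `k + 1` trees, the first root is replaced by its children. -/
theorem sumLaw_succ (hv : IsTotalProgeny q v) (k : ℕ) :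
    sumLaw v (k + 1) = (q.bind fun j => sumLaw v (k + j)).map (· + 1) := by
  refine eq_of_pgf_eq fun x hx => ?_
  have hbind : pgf (q.bind fun j => sumLaw v (k + j)) x = pgf v x ^ k * pgf q (pgf v x) := by
    rw [pgf_bind, pgf.eq_1 q, ← ENNReal.tsum_mul_left]
    exact tsum_congr fun j => by rw [pgf_sumLaw, pow_add]; ring
  rw [pgf_map_succ, hbind, pgf_sumLaw, pow_succ]
  nth_rewrite 2 [hv x hx]
  ring

theorem mean_eq_top (hv : IsTotalProgeny q v) (hc : IsCritical q) : mean v = ∞ := by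
  have hmean : mean v = mean v + 1 := by
    have := congrArg mean (hv.sumLaw_succ 0)
    simp only [zero_add] at this
    rwa [sumLaw_one, mean_map_succ, mean_bind_sumLaw, show mean q = 1 from hc, one_mul] at this
  by_contra H
  exact (ENNReal.lt_add_right H one_ne_zero).ne hmean

theorem sumLaw_eq_zero (hv : IsTotalProgeny q v) {n k : ℕ} (hnk : n < k) : sumLaw v k n = 0 := by
  induction n generalizing k with
  | zero =>
    obtain ⟨k, rfl⟩ := Nat.exists_eq_succ_of_ne_zero hnk.ne'
    rw [Nat.succ_eq_add_one, hv.sumLaw_succ, map_succ_apply_zero]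
  | succ n ih =>
    obtain ⟨k, rfl⟩ := Nat.exists_eq_succ_of_ne_zero (Nat.ne_zero_of_lt hnk)
    rw [Nat.succ_eq_add_one, hv.sumLaw_succ, map_succ_apply_succ, PMF.bind_apply]
    exact ENNReal.tsum_eq_zero.2 fun j => by rw [ih (by omega), mul_zero]

theorem toReal_sumLaw_succ (hv : IsTotalProgeny q v) (k m : ℕ) :
    (sumLaw v (k + 1) (m + k + 1)).toReal =
      ∑ x ∈ antidiagonal m, (q x.1).toReal * (sumLaw v (k + x.1) (m + k)).toReal := by
  rw [hv.sumLaw_succ, map_succ_apply_succ, PMF.bind_apply,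
    tsum_eq_sum (s := Finset.range (m + 1)), ENNReal.toReal_sum,
    Finset.Nat.sum_antidiagonal_eq_sum_range_succ
      (fun a _ => (q a).toReal * (sumLaw v (k + a) (m + k)).toReal)]
  · simp only [ENNReal.toReal_mul]
  · exact fun j _ => ENNReal.mul_ne_top (PMF.apply_ne_top _ _) (PMF.apply_ne_top _ _)
  · intro j hj
    rw [hv.sumLaw_eq_zero (by rw [Finset.mem_range] at hj; omega), mul_zero]

/-- The hitting time theorem: the `k` trees of a forest have `n` vertices in total if `n` is the
first time at which the random walk with steps `ζ - 1`, where `ζ` has law `q`, hits `-k`. -/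
theorem mul_toReal_sumLaw (hv : IsTotalProgeny q v) (k m : ℕ) :
    ((m + k : ℕ) : ℝ) * (sumLaw v k (m + k)).toReal = k * walkProb q (m + k) m := by
  obtain ⟨n, hn⟩ : ∃ n, n = m + k := ⟨_, rfl⟩
  induction n generalizing k m with
  | zero =>
    obtain ⟨rfl, rfl⟩ : m = 0 ∧ k = 0 := by omega
    simp
  | succ n ih =>
    rcases k with _ | k
    · obtain ⟨m, rfl⟩ : ∃ m', m = m' + 1 := ⟨n, by omega⟩
      simp [sumLaw]
    obtain rfl : n = m + k := by omega
    rcases Nat.eq_zero_or_pos (m + k) with h0 | hpos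
    · obtain ⟨rfl, rfl⟩ : m = 0 ∧ k = 0 := by omega
      simpa [sumLaw, walkProb_one] using hv.toReal_sumLaw_succ 0 0
    have hfirst : ((m + k : ℕ) : ℝ) * (sumLaw v (k + 1) (m + k + 1)).toReal =
        k * walkProb q (m + k + 1) m +
          ∑ x ∈ antidiagonal m, x.1 * (q x.1).toReal * walkProb q (m + k) x.2 := by
      rw [hv.toReal_sumLaw_succ, walkProb_succ, Finset.mul_sum, Finset.mul_sum,
        ← Finset.sum_add_distrib]
      refine Finset.sum_congr rfl fun x hx => ?_
      have hx' : x.2 + (k + x.1) = m + k := by rw [← mem_antidiagonal.1 hx]; ring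
      have hforest := ih (k + x.1) x.2 hx'.symm
      rw [hx'] at hforest
      push_cast at hforest ⊢
      linear_combination (q x.1).toReal * hforest
    have hstep := sum_mul_walkProb q (m + k) m
    have hne : ((m + k : ℕ) : ℝ) ≠ 0 := by positivity
    refine mul_left_cancel₀ hne ?_
    rw [← add_assoc]
    push_cast at hfirst hstep ⊢
    linear_combination (m + k + 1 : ℝ) * hfirst + hstep

theorem mul_toReal_apply_succ (hv : IsTotalProgeny q v) (m : ℕ) :
    ((m + 1 : ℕ) : ℝ) * (v (m + 1)).toReal = walkProb q (m + 1) m := by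
  have := hv.mul_toReal_sumLaw 1 m
  rwa [sumLaw_one, Nat.cast_one, one_mul] at this

theorem toReal_apply_succ (hv : IsTotalProgeny q v) (m : ℕ) :
    (v (m + 1)).toReal = walkProb q (m + 1) m / (m + 1 : ℕ) := by
  rw [eq_div_iff (by positivity), mul_comm, hv.mul_toReal_apply_succ]

theorem mean_eq_tsum_walkProb (hv : IsTotalProgeny q v) :
    mean v = ∑' m, ENNReal.ofReal (walkProb q (m + 1) m) := by
  rw [mean, tsum_eq_zero_add_tsum_succ, Nat.cast_zero, zero_mul, zero_add]
  refine tsum_congr fun m => ?_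
  rw [← hv.mul_toReal_apply_succ, ENNReal.ofReal_mul (Nat.cast_nonneg _), ENNReal.ofReal_natCast,
    ENNReal.ofReal_toReal (v.apply_ne_top _)]

theorem apply_succ_eq_zero (hv : IsTotalProgeny q v) (h : NonDegenerate q) {m : ℕ}
    (hm : ¬ period q ∣ m) : v (m + 1) = 0 := by
  have := hv.toReal_apply_succ m
  rw [walkProb_eq_zero_of_not_dvd h hm, zero_div, ENNReal.toReal_eq_zero_iff] at this
  exact this.resolve_right (v.apply_ne_top _)

theorem exists_forall_apply_succ_ne_zero (hv : IsTotalProgeny q v) (h : NonDegenerate q) :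
    ∃ m, ∀ n ≥ m, period q ∣ n → v (n + 1) ≠ 0 := by
  obtain ⟨m, hm⟩ := exists_forall_walkProb_self_pos h
  refine ⟨m, fun n hn hd H => ?_⟩
  have hpos := mul_pos (toReal_pos_of_ne_zero h.zero_pos.ne') (hm n hn hd)
  have hle := pow_mul_walkProb_le q n n 1
  rw [pow_one, ← hv.mul_toReal_apply_succ, H, ENNReal.toReal_zero, mul_zero] at hle
  exact hpos.not_ge hle

/-- If the walk decayed exponentially along the diagonal, the total progeny would have a finite
mean. -/
theorem exists_pow_le_walkProb_self (hv : IsTotalProgeny q v) (h : NonDegenerate q)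
    (hc : IsCritical q) {r : ℝ} (hr0 : 0 < r) (hr1 : r < 1) : ∃ k > 0, r ^ k ≤ walkProb q k k := by
  by_contra! H
  obtain ⟨e, he⟩ := apply_zero_add_apply_one_lt_one_iff.1 h.zero_add_one_lt_one
  have hpos : 0 < (q 0).toReal ^ e * (q (e + 2)).toReal :=
    mul_pos (pow_pos (toReal_pos_of_ne_zero h.zero_pos.ne') e) (toReal_pos_of_ne_zero he)
  set D := (q 0).toReal ^ e * (q (e + 2)).toReal
  have hle (m : ℕ) : walkProb q (m + 1) m ≤ D⁻¹ * r ^ m := by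
    rw [inv_mul_eq_div, le_div_iff₀ hpos]
    calc walkProb q (m + 1) m * D ≤ walkProb q (m + (e + 2)) (m + (e + 2)) :=
          walkProb_succ_mul_le q m e
      _ ≤ r ^ (m + (e + 2)) := (H _ (by omega)).le
      _ ≤ r ^ m := pow_le_pow_of_le_one hr0.le hr1.le (by omega)
  have hsum : Summable fun m : ℕ => D⁻¹ * r ^ m :=
    (summable_geometric_of_lt_one hr0.le hr1).mul_left _
  have hfin : mean v ≤ ENNReal.ofReal (∑' m : ℕ, D⁻¹ * r ^ m) := by
    rw [hv.mean_eq_tsum_walkProb, ENNReal.ofReal_tsum_of_nonneg (fun m => by positivity) hsum]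
    exact ENNReal.tsum_le_tsum fun m => ENNReal.ofReal_le_ofReal (hle m)
  rw [hv.mean_eq_top hc] at hfin
  exact ENNReal.ofReal_ne_top (top_le_iff.1 hfin)

theorem subexponentialDecay_walkProb_self (hv : IsTotalProgeny q v) (h : NonDegenerate q)
    (hc : IsCritical q) :
    SubexponentialDecay (atTop ⊓ 𝓟 {n | period q ∣ n}) id fun n => walkProb q n n := by
  intro r hr0 hr1
  obtain ⟨k, hk, hrk⟩ := hv.exists_pow_le_walkProb_self h hc hr0 hr1
  obtain ⟨C, hC, m, hm⟩ := exists_forall_mul_pow_le_walkProb_self h hr0 hr1 hk hrk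
  refine ⟨C, hC, eventually_inf_principal.2 ?_⟩
  filter_upwards [eventually_ge_atTop m] with n hn hd using hm n hn hd

end IsTotalProgeny

end TotalProgeny

/-! ### Ratio limits -/

namespace IsTotalProgeny

variable {q v : PMF ℕ}

theorem subexponentialDecay_walkProb (hv : IsTotalProgeny q v) (h : NonDegenerate q)
    (hc : IsCritical q) {i j : ℕ} (hj : period q ∣ j) (hij : j ≤ i + 1) :
    SubexponentialDecay atTop (fun t => period q * t + i)
      fun t => walkProb q (period q * t + i + 1) (period q * t + j) := by
  intro r hr0 hr1
  have h0 : 0 < (q 0).toReal := toReal_pos_of_ne_zero h.zero_pos.ne'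
  obtain ⟨C, hC, hdiag⟩ := hv.subexponentialDecay_walkProb_self h hc r hr0 hr1
  have htend : Tendsto (fun t => period q * t + j) atTop (atTop ⊓ 𝓟 {n | period q ∣ n}) := by
    refine tendsto_inf.2 ⟨tendsto_atTop_mono (fun t => ?_) tendsto_id,
      tendsto_principal.2 (Eventually.of_forall fun t => (dvd_mul_right _ t).add hj)⟩
    exact (Nat.le_mul_of_pos_left t (period_pos h)).trans (Nat.le_add_right _ _)
  obtain ⟨l, hl⟩ := Nat.exists_eq_add_of_le hij
  refine ⟨(q 0).toReal ^ l * (C * r), by positivity, ?_⟩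
  filter_upwards [htend.eventually hdiag] with t ht
  calc (q 0).toReal ^ l * (C * r) * r ^ (period q * t + i)
      = (q 0).toReal ^ l * (C * r ^ (period q * t + (i + 1))) := by ring
    _ ≤ (q 0).toReal ^ l * (C * r ^ (period q * t + j)) := by
        gcongr (q 0).toReal ^ l * (C * ?_)
        exact pow_le_pow_of_le_one hr0.le hr1.le (by omega)
    _ ≤ (q 0).toReal ^ l * walkProb q (period q * t + j) (period q * t + j) := by
        gcongr
        exact ht
    _ ≤ walkProb q (period q * t + j + l) (period q * t + j) := pow_mul_walkProb_le q _ _ l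
    _ = _ := by rw [show period q * t + j + l = period q * t + i + 1 by omega]

theorem walkProb_isEquivalent_step (hv : IsTotalProgeny q v) (h : NonDegenerate q)
    (hc : IsCritical q) {e i j : ℕ} (he : q e ≠ 0) (hj : period q ∣ j) (hij : j + e ≤ i + 1) :
    (fun t => walkProb q (period q * t + i) (period q * t + j)) ~[atTop]
      fun t => walkProb q (period q * t + (i + 1)) (period q * t + (j + e)) := by
  have hsub := hv.subexponentialDecay_walkProb h hc (hj.add (period_dvd h he)) hij
  simp only [← add_assoc] at hsub ⊢
  refine walkProb_isEquivalent he (tendsto_atTop_mono (fun t => ?_) tendsto_id) hsub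
  exact (Nat.le_mul_of_pos_left t (period_pos h)).trans (Nat.le_add_right _ _)

theorem walkProb_isEquivalent_add_left (hv : IsTotalProgeny q v) (h : NonDegenerate q)
    (hc : IsCritical q) {i j : ℕ} (k : ℕ) (hj : period q ∣ j) (hij : j ≤ i) :
    (fun t => walkProb q (period q * t + i) (period q * t + j)) ~[atTop]
      fun t => walkProb q (period q * t + (i + k)) (period q * t + j) := by
  induction k with
  | zero => exact Asymptotics.IsEquivalent.refl
  | succ k ih =>
    have hstep := hv.walkProb_isEquivalent_step h hc h.zero_pos.ne' hj
      (by omega : j + 0 ≤ i + k + 1)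
    exact ih.trans hstep

theorem walkProb_isEquivalent_of_le (hv : IsTotalProgeny q v) (h : NonDegenerate q)
    (hc : IsCritical q) {i i' j : ℕ} (hj : period q ∣ j) (hij : j ≤ i) (hij' : j ≤ i') :
    (fun t => walkProb q (period q * t + i) (period q * t + j)) ~[atTop]
      fun t => walkProb q (period q * t + i') (period q * t + j) := by
  have hleft := hv.walkProb_isEquivalent_add_left h hc i' hj hij
  rw [add_comm i i'] at hleft
  exact hleft.trans (hv.walkProb_isEquivalent_add_left h hc i hj hij').symm

theorem walkProb_isEquivalent_of_mem_closure (hv : IsTotalProgeny q v) (h : NonDegenerate q)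
    (hc : IsCritical q) {a : ℕ} (ha : a ∈ AddSubmonoid.closure q.support) {i i' j : ℕ}
    (hj : period q ∣ j) (hij : j ≤ i) (hij' : j + a ≤ i') :
    (fun t => walkProb q (period q * t + i) (period q * t + j)) ~[atTop]
      fun t => walkProb q (period q * t + i') (period q * t + (j + a)) := by
  induction ha using AddSubmonoid.closure_induction generalizing i j i' with
  | mem e he =>
    have he' : q e ≠ 0 := (PMF.mem_support_iff _ _).1 he
    refine ((hv.walkProb_isEquivalent_of_le h hc hj hij (by omega : j ≤ j + e)).trans
      (hv.walkProb_isEquivalent_step h hc he' hj (by omega))).trans ?_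
    exact hv.walkProb_isEquivalent_of_le h hc (hj.add (period_dvd h he')) (by omega) hij'
  | zero => exact hv.walkProb_isEquivalent_of_le h hc hj hij hij'
  | add a b ha _ iha ihb =>
    rw [← add_assoc] at hij' ⊢
    exact (iha hj hij le_rfl).trans (ihb (hj.add (period_dvd_of_mem_closure h ha)) le_rfl hij')

theorem walkProb_isEquivalent_of_dvd (hv : IsTotalProgeny q v) (h : NonDegenerate q)
    (hc : IsCritical q) {i i' j j' : ℕ} (hj : period q ∣ j) (hij : j ≤ i) (hj' : period q ∣ j')
    (hij' : j' ≤ i') :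
    (fun t => walkProb q (period q * t + i) (period q * t + j)) ~[atTop]
      fun t => walkProb q (period q * t + i') (period q * t + j') := by
  obtain ⟨m, hm⟩ := exists_forall_mem_closure_support h
  have hmem {a : ℕ} (ha : period q ∣ a) : period q * m + a ∈ AddSubmonoid.closure q.support :=
    hm _ ((Nat.le_mul_of_pos_left m (period_pos h)).trans (Nat.le_add_right _ _))
      ((dvd_mul_right _ m).add ha)
  have hleft := hv.walkProb_isEquivalent_of_mem_closure h hc (hmem hj') hj hij le_rfl
  have hright := hv.walkProb_isEquivalent_of_mem_closure h hc (hmem hj) hj' hij' le_rfl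
  rw [show j + (period q * m + j') = j' + (period q * m + j) by ring] at hleft
  exact hleft.trans hright.symm

theorem toReal_apply_isEquivalent_period (hv : IsTotalProgeny q v) (h : NonDegenerate q)
    (hc : IsCritical q) :
    (fun t => (v (period q * (t + 1) + 1)).toReal) ~[atTop]
      fun t => (v (period q * t + 1)).toReal := by
  simp only [hv.toReal_apply_succ]
  refine Asymptotics.IsEquivalent.div ?_ ?_
  · have hwalk := hv.walkProb_isEquivalent_of_dvd h hc dvd_rfl (Nat.le_succ (period q))
      (dvd_zero _) zero_le_one
    simpa only [mul_add, mul_one, add_assoc, add_zero] using hwalk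
  · have htop : Tendsto (fun t : ℕ => ‖((period q * t + 1 : ℕ) : ℝ)‖) atTop atTop := by
      simp only [Real.norm_natCast]
      refine tendsto_natCast_atTop_atTop.comp (tendsto_atTop_mono (fun t => ?_) tendsto_id)
      exact (Nat.le_mul_of_pos_left t (period_pos h)).trans (Nat.le_succ _)
    have hlittle : (fun _ => (period q : ℝ)) =o[atTop] fun t : ℕ => ((period q * t + 1 : ℕ) : ℝ) :=
      Asymptotics.isLittleO_const_left.2 (Or.inr htop)
    refine (Asymptotics.IsEquivalent.refl.add_isLittleO hlittle).congr_left
      (Eventually.of_forall fun t => ?_)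
    simp only [Pi.add_apply]
    push_cast
    ring

theorem toReal_apply_add_period_isEquivalent (hv : IsTotalProgeny q v) (h : NonDegenerate q)
    (hc : IsCritical q) :
    (fun n => (v (n + period q)).toReal) ~[atTop] fun n => (v n).toReal := by
  have hE := hv.toReal_apply_isEquivalent_period h hc
  rw [Asymptotics.IsEquivalent, Asymptotics.isLittleO_iff] at hE ⊢
  intro ε hε
  obtain ⟨T, hT⟩ := eventually_atTop.1 (hE hε)
  filter_upwards [eventually_ge_atTop (period q * T + 1)] with n hn
  obtain ⟨m, rfl⟩ : ∃ m, n = m + 1 := ⟨n - 1, by omega⟩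
  by_cases hd : period q ∣ m
  · obtain ⟨t, rfl⟩ := hd
    have hTt : T ≤ t := Nat.le_of_mul_le_mul_left (by omega : period q * T ≤ period q * t)
      (period_pos h)
    have hmul : period q * t + 1 + period q = period q * (t + 1) + 1 := by ring
    simpa only [Pi.sub_apply, hmul] using hT t hTt
  · have hd' : ¬ period q ∣ m + period q := fun H => hd ((Nat.dvd_add_left dvd_rfl).1 H)
    simp only [Pi.sub_apply, add_right_comm m 1, hv.apply_succ_eq_zero h hd,
      hv.apply_succ_eq_zero h hd', ENNReal.toReal_zero, sub_zero, norm_zero, mul_zero, le_refl]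

end IsTotalProgeny

/-! ### Windows -/

section Window

variable (q : PMF ℕ) (D : Set ℕ)

open Classical in
/-- The indicator function of `n + D`. -/
noncomputable def window (n m : ℕ) : ℝ≥0∞ := if n ≤ m ∧ m - n ∈ D then 1 else 0

/-- The mass which `q` gives to `n + D`. -/
noncomputable def windowMass (n : ℕ) : ℝ≥0∞ := ∑' m, q m * window D n m

variable {q D}

theorem window_eq_one {n m : ℕ} (hnm : n ≤ m) (hD : m - n ∈ D) : window D n m = 1 :=
  if_pos ⟨hnm, hD⟩

theorem window_eq_zero {n m : ℕ} (hnm : m < n) : window D n m = 0 :=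
  if_neg fun H => H.1.not_gt hnm

theorem window_le_one (n m : ℕ) : window D n m ≤ 1 := by
  rw [window]
  split_ifs
  exacts [le_rfl, zero_le_one]

theorem window_sub {n s : ℕ} (hs : s ≤ n) (m : ℕ) : window D (n - s) m = window D n (s + m) := by
  have hiff : (n - s ≤ m ∧ m - (n - s) ∈ D) ↔ n ≤ s + m ∧ s + m - n ∈ D := by
    rw [show m - (n - s) = s + m - n by omega]
    exact and_congr_left fun _ => by omega
  classical exact if_congr hiff rfl rfl

theorem window_univ_antitone (m : ℕ) : Antitone fun n => window Set.univ n m := by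
  intro a b hab
  simp only [window, Set.mem_univ, and_true]
  split_ifs with hb ha
  exacts [le_rfl, absurd (hab.trans hb) ha, zero_le_one, le_rfl]

theorem windowMass_sub {n s : ℕ} (hs : s ≤ n) :
    windowMass q D (n - s) = ∑' m, q m * window D n (s + m) :=
  tsum_congr fun m => by rw [window_sub hs]

theorem windowMass_ne_top (n : ℕ) : windowMass q D n ≠ ∞ := by
  refine ne_top_of_le_ne_top ENNReal.one_ne_top ?_
  rw [← q.tsum_coe]
  exact ENNReal.tsum_le_tsum fun m => mul_le_of_le_one_right' (window_le_one n m)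

theorem apply_le_windowMass {n m : ℕ} (hnm : n ≤ m) (hD : m - n ∈ D) :
    q m ≤ windowMass q D n := by
  refine le_trans (le_of_eq ?_) (ENNReal.le_tsum m)
  rw [window_eq_one hnm hD, mul_one]

theorem windowMass_ne_zero {n m : ℕ} (hm : q m ≠ 0) (hnm : n ≤ m) (hD : m - n ∈ D) :
    windowMass q D n ≠ 0 :=
  ((pos_iff_ne_zero.2 hm).trans_le (apply_le_windowMass hnm hD)).ne'

theorem windowMass_univ_antitone : Antitone (windowMass q Set.univ) := fun _ _ hab =>
  ENNReal.tsum_le_tsum fun m => mul_le_mul_right (window_univ_antitone m hab) _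

theorem add_windowMass_Iio_succ {d : ℕ} (hd : 0 < d) (n : ℕ) :
    q n + windowMass q (Set.Iio d) (n + 1) = windowMass q (Set.Iio d) n + q (n + d) := by
  have hpt (a : ℕ) : q a = ∑' m, q m * (if m = a then 1 else 0) := by
    simp only [mul_ite, mul_one, mul_zero, tsum_ite_eq]
  rw [hpt n, hpt (n + d), windowMass, windowMass, ← ENNReal.tsum_add, ← ENNReal.tsum_add]
  refine tsum_congr fun m => ?_
  rw [← mul_add, ← mul_add, window, window]
  congr 1
  simp only [Set.mem_Iio]
  split_ifs <;> first | omega | simp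

theorem toReal_windowMass_Iio_isEquivalent {d : ℕ} (hd : 0 < d)
    (hq : (fun n => (q (n + d)).toReal) ~[atTop] fun n => (q n).toReal) :
    (fun n => (windowMass q (Set.Iio d) (n + 1)).toReal) ~[atTop]
      fun n => (windowMass q (Set.Iio d) n).toReal := by
  have hle (n : ℕ) : (q n).toReal ≤ (windowMass q (Set.Iio d) n).toReal :=
    ENNReal.toReal_mono (windowMass_ne_top n)
      (apply_le_windowMass le_rfl (by rwa [Nat.sub_self, Set.mem_Iio]))
  have hO : (fun n => (q n).toReal) =O[atTop] fun n => (windowMass q (Set.Iio d) n).toReal :=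
    Asymptotics.IsBigO.of_norm_le fun n => by
      rw [Real.norm_of_nonneg ENNReal.toReal_nonneg]
      exact hle n
  refine (hq.isLittleO.trans_isBigO hO).congr_left fun n => ?_
  have hsum := congrArg ENNReal.toReal (add_windowMass_Iio_succ (q := q) hd n)
  rw [ENNReal.toReal_add (q.apply_ne_top _) (windowMass_ne_top _),
    ENNReal.toReal_add (windowMass_ne_top _) (q.apply_ne_top _)] at hsum
  simp only [Pi.sub_apply]
  linarith

end Window

/-! ### One big summand -/

theorem tsum_mul_liminf_le {ι : Type*} [Countable ι] {w : ι → ℝ≥0∞} (hw : ∀ s, w s ≠ ∞)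
    (f : ℕ → ι → ℝ≥0∞) :
    ∑' s, w s * liminf (fun n => f n s) atTop ≤ liminf (fun n => ∑' s, w s * f n s) atTop := by
  let _ : MeasurableSpace ι := ⊤
  calc ∑' s, w s * liminf (fun n => f n s) atTop
      = ∑' s, liminf (fun n => w s * f n s) atTop :=
        tsum_congr fun s => (ENNReal.liminf_const_mul_of_ne_top (hw s)).symm
    _ = ∫⁻ s, liminf (fun n => w s * f n s) atTop ∂Measure.count := (lintegral_count _).symm
    _ ≤ liminf (fun n => ∫⁻ s, w s * f n s ∂Measure.count) atTop :=
        lintegral_liminf_le fun n => measurable_of_countable _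
    _ = _ := by simp only [lintegral_count]

theorem liminf_add_liminf_le (f g : ℕ → ℝ≥0∞) :
    liminf f atTop + liminf g atTop ≤ liminf (fun n => f n + g n) atTop := by
  have hbool := tsum_mul_liminf_le (w := fun _ : Bool => 1) (fun _ => ENNReal.one_ne_top)
    fun n b => if b then f n else g n
  simpa [tsum_bool, add_comm] using hbool

theorem le_liminf_tsum_apply_mul (r : PMF ℕ) {c : ℝ≥0∞} {f : ℕ → ℕ → ℝ≥0∞}
    (hf : ∀ s, c ≤ liminf (fun n => f n s) atTop) :
    c ≤ liminf (fun n => ∑' s, r s * f n s) atTop :=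
  calc c = ∑' s, r s * c := by rw [ENNReal.tsum_mul_right, PMF.tsum_coe, one_mul]
    _ ≤ ∑' s, r s * liminf (fun n => f n s) atTop :=
        ENNReal.tsum_le_tsum fun s => mul_le_mul_right (hf s) _
    _ ≤ _ := tsum_mul_liminf_le (fun s => r.apply_ne_top s) f

/-- Two numbers whose sum is at least `n` cannot both be less than `n / 2`: the events that the
first `k` summands, or the last one, contribute less than `n / 2` are thus disjoint. -/
theorem add_tsum_ite_windowMass_le_windowMass_sumLaw_succ (q : PMF ℕ) (D : Set ℕ) (k n : ℕ) :
    ∑' s, sumLaw q k s * (if 2 * s < n then windowMass q D (n - s) else 0) +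
      ∑' j, q j * (if 2 * j < n then windowMass (sumLaw q k) D (n - j) else 0) ≤
    windowMass (sumLaw q (k + 1)) D n := by
  have hmass (r : PMF ℕ) (s : ℕ) : (if 2 * s < n then windowMass r D (n - s) else 0) =
      ∑' j, r j * (if 2 * s < n then window D n (s + j) else 0) := by
    split_ifs with hs
    · rw [windowMass_sub (by omega)]
    · simp only [mul_zero, tsum_zero]
  have hswap : ∑' j, q j * (if 2 * j < n then windowMass (sumLaw q k) D (n - j) else 0) =
      ∑' s, sumLaw q k s * ∑' j, q j * (if 2 * j < n then window D n (s + j) else 0) := by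
    simp only [hmass, ← ENNReal.tsum_mul_left]
    rw [ENNReal.tsum_comm]
    simp only [mul_left_comm (q _), add_comm]
  rw [hswap, windowMass, tsum_sumLaw_succ_mul, ← ENNReal.tsum_add]
  refine ENNReal.tsum_le_tsum fun s => ?_
  rw [hmass, ← mul_add, ← ENNReal.tsum_add]
  refine mul_le_mul_right (ENNReal.tsum_le_tsum fun j => ?_) _
  rw [← mul_add]
  refine mul_le_mul_right ?_ _
  rcases lt_or_ge (s + j) n with hn | hn
  · simp only [window_eq_zero hn, ite_self, add_zero, le_refl]
  · split_ifs
    · omega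
    all_goals simp

/-- A law whose windows of shape `D` have asymptotically non-increasing masses, up to a factor
tending to `1`. -/
structure LongTailed (q : PMF ℕ) (D : Set ℕ) : Prop where
  eventually_ne_zero : ∀ᶠ n in atTop, windowMass q D n ≠ 0
  one_le_liminf : ∀ a : ℕ,
    1 ≤ liminf (fun n => windowMass q D (n - a) / windowMass q D n) atTop

namespace LongTailed

variable {q : PMF ℕ} {D : Set ℕ}

theorem le_liminf (h : LongTailed q D) (k a : ℕ) :
    (k : ℝ≥0∞) ≤ liminf (fun n => windowMass (sumLaw q k) D (n - a) / windowMass q D n) atTop := by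
  induction k generalizing a with
  | zero => simp
  | succ k ih =>
    have hshift (r : PMF ℕ) (s : ℕ) :
        liminf (fun n => windowMass r D (n - (a + s)) / windowMass q D n) atTop ≤
        liminf (fun n => (if 2 * s < n - a then windowMass r D (n - a - s) else 0) /
          windowMass q D n) atTop := by
      refine liminf_le_liminf ?_
      filter_upwards [eventually_gt_atTop (2 * s + a)] with n hn
      rw [if_pos (by omega), Nat.sub_sub]
    have hlast := le_liminf_tsum_apply_mul (sumLaw q k) fun s =>
      (h.one_le_liminf (a + s)).trans (hshift q s)
    have hfirst := le_liminf_tsum_apply_mul q fun j => (ih (a + j)).trans (hshift (sumLaw q k) j)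
    calc ((k + 1 : ℕ) : ℝ≥0∞) = 1 + k := by push_cast; ring
      _ ≤ _ := (add_le_add hlast hfirst).trans (liminf_add_liminf_le _ _)
      _ ≤ _ := by
        refine liminf_le_liminf (Eventually.of_forall fun n => le_trans (le_of_eq ?_)
          (ENNReal.div_le_div_right
            (add_tsum_ite_windowMass_le_windowMass_sumLaw_succ q D k (n - a)) _))
        simp only [div_eq_mul_inv, add_mul, ← ENNReal.tsum_mul_right, mul_assoc]

theorem of_isEquivalent (hne : ∀ᶠ n in atTop, windowMass q D n ≠ 0)
    (h : (fun n => (windowMass q D (n + 1)).toReal) ~[atTop]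
      fun n => (windowMass q D n).toReal) : LongTailed q D := by
  refine ⟨hne, fun a => ?_⟩
  have hequiv : (fun n => (windowMass q D (n - a)).toReal) ~[atTop]
      fun n => (windowMass q D n).toReal := by
    induction a with
    | zero => exact Asymptotics.IsEquivalent.refl
    | succ a ih =>
      refine Asymptotics.IsEquivalent.trans ?_ ih
      refine ((h.comp_tendsto (tendsto_sub_atTop_nat (a + 1))).congr_left ?_).symm
      filter_upwards [eventually_gt_atTop a] with n hn
      simp only [Function.comp_apply, show n - (a + 1) + 1 = n - a by omega]
  have hne' : ∀ᶠ n in atTop, (windowMass q D n).toReal ≠ 0 :=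
    hne.mono fun n hn => (ENNReal.toReal_pos hn (windowMass_ne_top n)).ne'
  have hlim := (Asymptotics.isEquivalent_iff_tendsto_one hne').1 hequiv
  have hlim' := ENNReal.tendsto_ofReal hlim
  rw [ENNReal.ofReal_one] at hlim'
  refine (hlim'.congr' ?_).liminf_eq.ge
  filter_upwards [hne] with n hn
  rw [Pi.div_apply, ← ENNReal.toReal_div,
    ENNReal.ofReal_toReal (ENNReal.div_ne_top (windowMass_ne_top _) hn)]

theorem univ (hne : ∀ n, windowMass q Set.univ n ≠ 0) : LongTailed q Set.univ := by
  refine ⟨Eventually.of_forall hne, fun a => ?_⟩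
  refine le_liminf_of_le (by isBoundedDefault) (Eventually.of_forall fun n => ?_)
  rw [ENNReal.le_div_iff_mul_le (Or.inl (hne n)) (Or.inl (windowMass_ne_top n)), one_mul]
  exact windowMass_univ_antitone (Nat.sub_le n a)

end LongTailed

namespace IsTotalProgeny

variable {q v : PMF ℕ}

theorem windowMass_ne_zero (hv : IsTotalProgeny q v) (h : NonDegenerate q) {D : Set ℕ}
    (hD : Set.Iio (period q) ⊆ D) : ∀ᶠ n in atTop, windowMass v D n ≠ 0 := by
  obtain ⟨m, hm⟩ := hv.exists_forall_apply_succ_ne_zero h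
  have hd := period_pos h
  filter_upwards [eventually_gt_atTop m] with n hn
  set d := period q
  have hdiv := Nat.div_add_mod (n - 1 + (d - 1)) d
  have hmod := Nat.mod_lt (n - 1 + (d - 1)) hd
  exact RandomTree.windowMass_ne_zero
    (hm (d * ((n - 1 + (d - 1)) / d)) (by omega) (dvd_mul_right _ _)) (by omega)
    (hD (Set.mem_Iio.2 (by omega)))

theorem longTailed_Iio (hv : IsTotalProgeny q v) (h : NonDegenerate q) (hc : IsCritical q) :
    LongTailed v (Set.Iio (period q)) :=
  LongTailed.of_isEquivalent (hv.windowMass_ne_zero h subset_rfl)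
    (toReal_windowMass_Iio_isEquivalent (period_pos h)
      (hv.toReal_apply_add_period_isEquivalent h hc))

theorem windowMass_univ_ne_zero (hv : IsTotalProgeny q v) (h : NonDegenerate q) (n : ℕ) :
    windowMass v Set.univ n ≠ 0 := by
  obtain ⟨m, hm, hnm⟩ := ((hv.windowMass_ne_zero h (Set.subset_univ _)).and
    (eventually_ge_atTop n)).exists
  exact ((pos_iff_ne_zero.2 hm).trans_le (windowMass_univ_antitone hnm)).ne'

theorem longTailed_univ (hv : IsTotalProgeny q v) (h : NonDegenerate q) :
    LongTailed v Set.univ :=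
  LongTailed.univ (hv.windowMass_univ_ne_zero h)

end IsTotalProgeny

namespace PlaneTree

/-! ### Decomposition of a tree at its root -/

section Root

variable {t : PlaneTree} {u v : List ℕ} {h i : ℕ}

theorem mem_restrict : u ∈ (restrict h t).nodes ↔ u ∈ t.nodes ∧ u.length ≤ h := Iff.rfl

theorem mem_subtree : v ∈ (subtree i t).nodes ↔ v = [] ∨ i :: v ∈ t.nodes := Iff.rfl

theorem mem_leaves : u ∈ t.leaves ↔ u ∈ t.nodes ∧ t.outdegree u = 0 := Iff.rfl

theorem mem_of_prefix (h : u <+: v) (hv : v ∈ t.nodes) : u ∈ t.nodes := by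
  obtain ⟨w, rfl⟩ := h
  induction w using List.reverseRecOn with
  | nil => rwa [List.append_nil] at hv
  | append_singleton w i ih =>
    rw [← List.append_assoc] at hv
    exact ih (t.parent_mem _ _ hv)

theorem outdegree_eq_iff (hu : u ∈ t.nodes) (k : ℕ) :
    t.outdegree u = k ↔ ∀ i, u ++ [i] ∈ t.nodes ↔ i < k := by
  have hcard {m : ℕ} (hm : ∀ i, u ++ [i] ∈ t.nodes ↔ i < m) : t.outdegree u = m := by
    rw [outdegree, show {i : ℕ | u ++ [i] ∈ t.nodes} = Set.Iio m from Set.ext hm,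
      Set.ncard_eq_toFinset_card', Set.toFinset_Iio, Nat.card_Iio]
  refine ⟨?_, hcard⟩
  rintro rfl
  obtain ⟨m, hm⟩ := t.children u hu
  rwa [hcard hm]

theorem append_mem_iff (hu : u ∈ t.nodes) (i : ℕ) : u ++ [i] ∈ t.nodes ↔ i < t.outdegree u :=
  (outdegree_eq_iff hu _).1 rfl i

theorem cons_mem_iff (i : ℕ) (v : List ℕ) :
    i :: v ∈ t.nodes ↔ i < t.outdegree [] ∧ v ∈ (subtree i t).nodes := by
  rw [← append_mem_iff t.root_mem, List.nil_append, mem_subtree]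
  constructor
  · exact fun h => ⟨mem_of_prefix ⟨v, rfl⟩ h, Or.inr h⟩
  · rintro ⟨hi, rfl | hv⟩
    exacts [hi, hv]

theorem outdegree_subtree (t : PlaneTree) (i : ℕ) (u : List ℕ) :
    (subtree i t).outdegree u = t.outdegree (i :: u) := by
  simp only [outdegree, mem_subtree, List.append_eq_nil_iff, List.cons_ne_self, and_false,
    false_or, List.cons_append]

theorem cons_mem_leaves_iff (i : ℕ) (v : List ℕ) :
    i :: v ∈ t.leaves ↔ i < t.outdegree [] ∧ v ∈ (subtree i t).leaves := by
  rw [mem_leaves, mem_leaves, cons_mem_iff, outdegree_subtree, and_assoc]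

end Root

section Restrict

variable {h : ℕ} {s t : PlaneTree}

theorem restrict_eq_iff :
    restrict h s = restrict h t ↔ ∀ u : List ℕ, u.length ≤ h → (u ∈ s.nodes ↔ u ∈ t.nodes) := by
  simp only [PlaneTree.ext_iff, Set.ext_iff, mem_restrict, and_congr_left_iff]

theorem outdegree_congr (e : restrict h s = restrict h t) {u : List ℕ} (hu : u.length < h) :
    s.outdegree u = t.outdegree u := by
  have hmem (i : ℕ) : u ++ [i] ∈ s.nodes ↔ u ++ [i] ∈ t.nodes :=
    restrict_eq_iff.1 e _ (by simpa using hu)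
  simp only [outdegree, hmem]

theorem restrict_subtree (e : restrict (h + 1) s = restrict (h + 1) t) (i : ℕ) :
    restrict h (subtree i s) = restrict h (subtree i t) :=
  restrict_eq_iff.2 fun v hv => by
    rw [mem_subtree, mem_subtree, restrict_eq_iff.1 e (i :: v) (Nat.succ_le_succ hv)]

theorem restrict_succ_eq_iff :
    restrict (h + 1) s = restrict (h + 1) t ↔ s.outdegree [] = t.outdegree [] ∧
      ∀ i : Fin (t.outdegree []), restrict h (subtree i s) = restrict h (subtree i t) := by
  refine ⟨fun e => ⟨outdegree_congr e h.succ_pos, fun i => restrict_subtree e i⟩, ?_⟩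
  rintro ⟨hdeg, hsub⟩
  rw [restrict_eq_iff]
  rintro (_ | ⟨i, v⟩) hu
  · exact iff_of_true s.root_mem t.root_mem
  · rw [cons_mem_iff, cons_mem_iff, hdeg]
    exact and_congr_right fun hi =>
      restrict_eq_iff.1 (hsub ⟨i, hi⟩) v (Nat.le_of_succ_le_succ hu)

end Restrict

/-! ### Words sorted by their first letter -/

section Cons

variable {n : ℕ}

theorem encard_iUnion_cons (A : Fin n → Set (List ℕ)) :
    (⋃ i : Fin n, List.cons (i : ℕ) '' A i).encard = ∑ i, (A i).encard := by
  rw [Set.encard_iUnion_of_finite, finsum_eq_sum_of_fintype]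
  · exact Finset.sum_congr rfl fun i _ => (List.cons_injective).encard_image _
  · intro i j hij
    refine Set.disjoint_left.2 ?_
    rintro _ ⟨v, _, rfl⟩ ⟨w, _, hw⟩
    exact hij (Fin.ext (List.cons.inj hw).1.symm)

theorem cons_mem_iUnion_cons (A : ℕ → Set (List ℕ)) (i : ℕ) (v : List ℕ) :
    i :: v ∈ ⋃ j : Fin n, List.cons (j : ℕ) '' A j ↔ i < n ∧ v ∈ A i := by
  simp only [Set.mem_iUnion, Set.mem_image, List.cons.injEq]
  constructor
  · rintro ⟨j, w, hw, rfl, rfl⟩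
    exact ⟨j.2, hw⟩
  · exact fun ⟨hi, hv⟩ => ⟨⟨i, hi⟩, v, hv, rfl, rfl⟩

theorem nil_notMem_iUnion_cons (A : Fin n → Set (List ℕ)) :
    [] ∉ ⋃ j : Fin n, List.cons (j : ℕ) '' A j := by
  simp

/-- The words whose first letter `i` is less than `n` and whose other letters form a word
of `F i`. -/
def consUnion (F : Fin n → Finset (List ℕ)) : Finset (List ℕ) :=
  Finset.univ.biUnion fun i => (F i).map ⟨List.cons (i : ℕ), List.cons_injective⟩

variable (F : Fin n → Finset (List ℕ))

theorem cons_mem_consUnion {i : ℕ} {v : List ℕ} :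
    i :: v ∈ consUnion F ↔ ∃ hi : i < n, v ∈ F ⟨i, hi⟩ := by
  simp only [consUnion, Finset.mem_biUnion, Finset.mem_univ, true_and, Finset.mem_map,
    Function.Embedding.coeFn_mk, List.cons.injEq]
  constructor
  · rintro ⟨j, w, hw, rfl, rfl⟩
    exact ⟨j.2, hw⟩
  · exact fun ⟨hi, hv⟩ => ⟨⟨i, hi⟩, v, hv, rfl, rfl⟩

theorem nil_notMem_consUnion : [] ∉ consUnion F := by
  simp [consUnion]

theorem pairwiseDisjoint_map_cons : (Set.univ : Set (Fin n)).PairwiseDisjoint fun i =>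
    (F i).map ⟨List.cons (i : ℕ), List.cons_injective⟩ := by
  intro i _ j _ hij
  simp only [Function.onFun, Finset.disjoint_left, Finset.mem_map, Function.Embedding.coeFn_mk,
    not_exists, not_and]
  rintro _ ⟨v, _, rfl⟩ w _ hw
  exact hij (Fin.ext (List.cons.inj hw).1.symm)

@[to_additive]
theorem prod_consUnion {M : Type*} [CommMonoid M] (f : List ℕ → M) :
    ∏ u ∈ consUnion F, f u = ∏ i : Fin n, ∏ v ∈ F i, f ((i : ℕ) :: v) := by
  rw [consUnion, Finset.prod_biUnion ((pairwiseDisjoint_map_cons F).subset (Set.subset_univ _))]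
  simp only [Finset.prod_map, Function.Embedding.coeFn_mk]

end Cons

section Count

variable {t : PlaneTree}

theorem size_eq (t : PlaneTree) :
    t.size = 1 + ∑ i : Fin (t.outdegree []), (subtree i t).size := by
  have hnodes : t.nodes =
      {[]} ∪ ⋃ i : Fin (t.outdegree []), List.cons (i : ℕ) '' (subtree i t).nodes := by
    ext (_ | ⟨i, v⟩)
    · exact iff_of_true t.root_mem (Or.inl rfl)
    · rw [cons_mem_iff, Set.mem_union, cons_mem_iUnion_cons fun i => (subtree i t).nodes]
      simp
  rw [size, hnodes, Set.encard_union_eq, Set.encard_singleton, encard_iUnion_cons]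
  · rfl
  · exact Set.disjoint_singleton_left.2 (nil_notMem_iUnion_cons _)

theorem numLeaves_eq (t : PlaneTree) :
    t.numLeaves = ((if t.outdegree [] = 0 then 1 else 0 : ℕ) : ℕ∞) +
      ∑ i : Fin (t.outdegree []), (subtree i t).numLeaves := by
  have hleaves : t.leaves = {u | u = [] ∧ t.outdegree [] = 0} ∪
      ⋃ i : Fin (t.outdegree []), List.cons (i : ℕ) '' (subtree i t).leaves := by
    ext (_ | ⟨i, v⟩)
    · simp [mem_leaves, t.root_mem]
    · rw [cons_mem_leaves_iff, Set.mem_union, cons_mem_iUnion_cons fun i => (subtree i t).leaves]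
      simp
  rw [numLeaves, hleaves, Set.encard_union_eq, encard_iUnion_cons]
  · congr 1
    split_ifs with ht <;> simp [ht]
  · rw [Set.disjoint_left]
    rintro _ ⟨rfl, _⟩
    exact nil_notMem_iUnion_cons _

end Count

/-! ### Topology and measurability -/

section Topology

variable {s t : PlaneTree} {U : Set PlaneTree}

theorem dist_le_iff (h : ℕ) :
    dist s t ≤ ((2 : ℝ) ^ h)⁻¹ ↔ restrict h s = restrict h t := by
  change treeDist s t ≤ _ ↔ _
  by_cases hst : s = t
  · subst hst
    simp [treeDist]
  · rw [treeDist, if_neg hst, inv_le_inv₀ (by positivity) (by positivity),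
      pow_le_pow_iff_right₀ one_lt_two]
    exact ⟨fun hh => restrict_mono hh
      (Nat.sSup_mem ⟨0, restrict_zero s t⟩ (agreement_bddAbove hst)),
      le_csSup (agreement_bddAbove hst)⟩

theorem isOpen_iff_restrict :
    IsOpen U ↔ ∀ t ∈ U, ∃ h, ∀ s, restrict h s = restrict h t → s ∈ U := by
  rw [Metric.isOpen_iff]
  refine forall₂_congr fun t _ => ?_
  constructor
  · rintro ⟨ε, hε, hball⟩
    obtain ⟨h, hh⟩ := exists_pow_lt_of_lt_one hε (by norm_num : (2 : ℝ)⁻¹ < 1)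
    refine ⟨h, fun s hs => hball (Metric.mem_ball.2 ?_)⟩
    exact ((dist_le_iff h).2 hs).trans_lt (by rwa [← inv_pow])
  · rintro ⟨h, hh⟩
    exact ⟨((2 : ℝ) ^ h)⁻¹, by positivity,
      fun s hs => hh s ((dist_le_iff h).1 (Metric.mem_ball.1 hs).le)⟩

theorem isOpen_of_restrict (h : ℕ)
    (H : ∀ s t, restrict h s = restrict h t → t ∈ U → s ∈ U) : IsOpen U :=
  isOpen_iff_restrict.2 fun t ht => ⟨h, fun s hs => H s t hs ht⟩

/-- The trees that coincide with `t` up to height `h`; they form the closed ball of radius `2⁻ʰ`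
about `t`. -/
def levelBall (h : ℕ) (t : PlaneTree) : Set PlaneTree :=
  {s | restrict h s = restrict h t}

theorem mem_levelBall {h : ℕ} : s ∈ levelBall h t ↔ restrict h s = restrict h t := Iff.rfl

theorem measurableSet_levelBall (h : ℕ) (t : PlaneTree) : MeasurableSet (levelBall h t) :=
  (isOpen_of_restrict h fun _ _ e ht => e.trans ht).measurableSet

theorem measurable_outdegree_nil : Measurable fun t : PlaneTree => t.outdegree [] := by
  refine measurable_to_countable' fun n => (isOpen_of_restrict 1 fun s t e ht => ?_).measurableSet
  rw [Set.mem_preimage, Set.mem_singleton_iff] at ht ⊢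
  rw [outdegree_congr e (Nat.lt_succ_self _), ht]

theorem measurable_subtree (i : ℕ) : Measurable (subtree i) := by
  refine Continuous.measurable ⟨fun U hU => ?_⟩
  rw [isOpen_iff_restrict] at hU ⊢
  intro t ht
  obtain ⟨h, hh⟩ := hU _ ht
  exact ⟨h + 1, fun s hs => hh _ (restrict_subtree hs i)⟩

theorem measurable_size : Measurable size :=
  measurable_encard.comp <| measurable_set_iff.2 fun u => measurableSet_setOfPred.1
    (isOpen_of_restrict u.length fun _ _ e ht =>
      (restrict_eq_iff.1 e u le_rfl).2 ht).measurableSet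

theorem measurable_numLeaves : Measurable numLeaves :=
  measurable_encard.comp <| measurable_set_iff.2 fun u => measurableSet_setOfPred.1
    (isOpen_of_restrict (U := {t | u ∈ t.leaves}) (u.length + 1) fun _ _ e ht =>
      ⟨(restrict_eq_iff.1 e u (Nat.le_succ _)).2 ht.1,
        (outdegree_congr e (Nat.lt_succ_self _)).trans ht.2⟩).measurableSet

end Topology

/-! ### Vertices below and at a given height -/

/-- The vertices of height less than `h`. -/
noncomputable def nodesBelow : ℕ → PlaneTree → Finset (List ℕ)
  | 0, _ => ∅
  | h + 1, t => insert [] (consUnion fun i : Fin (t.outdegree []) => nodesBelow h (subtree i t))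

/-- The vertices of height `h`. -/
noncomputable def levelNodes : ℕ → PlaneTree → Finset (List ℕ)
  | 0, _ => {[]}
  | h + 1, t => consUnion fun i : Fin (t.outdegree []) => levelNodes h (subtree i t)

/-- The number of leaves of height less than `h`. -/
noncomputable def numLeavesBelow (h : ℕ) (t : PlaneTree) : ℕ :=
  {u ∈ nodesBelow h t | t.outdegree u = 0}.card

/-- The probability that the vertices of height less than `h` of a Galton–Watson tree with
offspring distribution `p` have the same outdegrees as in `t`. -/
noncomputable def weight (p : PMF ℕ) (h : ℕ) (t : PlaneTree) : ℝ≥0∞ :=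
  ∏ u ∈ nodesBelow h t, p (t.outdegree u)

section Level

variable {h : ℕ} {s t : PlaneTree} {u : List ℕ}

theorem mem_nodesBelow : u ∈ nodesBelow h t ↔ u ∈ t.nodes ∧ u.length < h := by
  induction h generalizing t u with
  | zero => simp [nodesBelow]
  | succ h ih =>
    rcases u with _ | ⟨i, v⟩
    · simp [nodesBelow, t.root_mem]
    · rw [cons_mem_iff, nodesBelow, Finset.mem_insert, cons_mem_consUnion]
      simp [ih, and_assoc, and_left_comm]

theorem mem_levelNodes : u ∈ levelNodes h t ↔ u ∈ t.nodes ∧ u.length = h := by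
  induction h generalizing t u with
  | zero =>
    rw [levelNodes, Finset.mem_singleton, List.length_eq_zero_iff]
    exact ⟨fun h => ⟨h ▸ t.root_mem, h⟩, And.right⟩
  | succ h ih =>
    rcases u with _ | ⟨i, v⟩
    · simp [levelNodes, nil_notMem_consUnion]
    · rw [cons_mem_iff, levelNodes, cons_mem_consUnion]
      simp [ih, and_assoc, and_left_comm]

theorem card_levelNodes_succ (h : ℕ) (t : PlaneTree) :
    (levelNodes (h + 1) t).card =
      ∑ i : Fin (t.outdegree []), (levelNodes h (subtree i t)).card := by
  simp only [Finset.card_eq_sum_ones, levelNodes, sum_consUnion]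

theorem numLeavesBelow_succ (h : ℕ) (t : PlaneTree) :
    numLeavesBelow (h + 1) t = (if t.outdegree [] = 0 then 1 else 0) +
      ∑ i : Fin (t.outdegree []), numLeavesBelow h (subtree i t) := by
  simp only [numLeavesBelow, Finset.card_filter, nodesBelow,
    Finset.sum_insert (nil_notMem_consUnion _), sum_consUnion, outdegree_subtree]

theorem weight_succ (p : PMF ℕ) (h : ℕ) (t : PlaneTree) :
    weight p (h + 1) t =
      p (t.outdegree []) * ∏ i : Fin (t.outdegree []), weight p h (subtree i t) := by
  rw [weight, nodesBelow, Finset.prod_insert (nil_notMem_consUnion _), prod_consUnion]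
  simp only [weight, outdegree_subtree]

theorem weight_le_one (p : PMF ℕ) (h : ℕ) (t : PlaneTree) : weight p h t ≤ 1 :=
  Finset.prod_le_one' fun _ _ => p.coe_le_one _

theorem restrict_eq_iff_nodesBelow_eq :
    restrict h s = restrict h t ↔ nodesBelow (h + 1) s = nodesBelow (h + 1) t := by
  simp only [restrict_eq_iff, Finset.ext_iff, mem_nodesBelow, Nat.lt_succ_iff,
    and_congr_left_iff]

theorem countable_range_restrict (h : ℕ) : (Set.range (restrict h)).Countable := by
  have hidem (t : PlaneTree) : restrict h (restrict h t) = restrict h t := by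
    rw [restrict_eq_iff]
    exact fun u hu => and_iff_left hu
  refine Set.MapsTo.countable_of_injOn (f := nodesBelow (h + 1)) (Set.mapsTo_univ _ _) ?_
    Set.countable_univ
  rintro _ ⟨s, rfl⟩ _ ⟨t, rfl⟩ e
  rwa [← restrict_eq_iff_nodesBelow_eq, hidem, hidem] at e

end Level

/-! ### Open sets as countable unions of level balls -/

/-- The trees of height at most `h` all of whose extensions above height `h` lie in `U`. -/
def truncations (h : ℕ) (U : Set PlaneTree) : Set PlaneTree :=
  {c ∈ Set.range (restrict h) | restrict h ⁻¹' {c} ⊆ U}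

section Truncations

variable {U : Set PlaneTree}

theorem countable_truncations (h : ℕ) (U : Set PlaneTree) : (truncations h U).Countable :=
  (countable_range_restrict h).mono (Set.sep_subset _ _)

theorem mem_preimage_truncations {h : ℕ} {t : PlaneTree} :
    t ∈ restrict h ⁻¹' truncations h U ↔ levelBall h t ⊆ U :=
  and_iff_right ⟨t, rfl⟩

theorem monotone_preimage_truncations (U : Set PlaneTree) :
    Monotone fun h => restrict h ⁻¹' truncations h U := fun _ _ hk _ ht =>
  mem_preimage_truncations.2 fun _ hs =>
    mem_preimage_truncations.1 ht (restrict_mono hk hs)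

theorem iUnion_preimage_truncations (hU : IsOpen U) :
    ⋃ h, restrict h ⁻¹' truncations h U = U := by
  ext t
  simp only [Set.mem_iUnion, mem_preimage_truncations]
  exact ⟨fun ⟨_, hh⟩ => hh rfl, isOpen_iff_restrict.1 hU t⟩

theorem measurable_of_levelBall {α : Type*} [MeasurableSpace α] {f : α → PlaneTree}
    (hf : ∀ h t, MeasurableSet (f ⁻¹' levelBall h t)) : Measurable f := by
  refine measurable_of_isOpen fun U hU => ?_
  rw [← iUnion_preimage_truncations hU, Set.preimage_iUnion]
  refine MeasurableSet.iUnion fun h => ?_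
  rw [← Set.biUnion_preimage_singleton (restrict h), Set.preimage_iUnion₂]
  refine MeasurableSet.biUnion (countable_truncations h U) ?_
  rintro _ ⟨⟨t, rfl⟩, _⟩
  exact hf h t

theorem measurable_of_measurableSet_mem {α : Type*} [MeasurableSpace α] {f : α → PlaneTree}
    (hf : ∀ u, MeasurableSet {a | u ∈ (f a).nodes}) : Measurable f := by
  refine measurable_of_levelBall fun h t => ?_
  simp only [Set.preimage, mem_levelBall, restrict_eq_iff, measurableSet_setOfPred]
  exact Measurable.forall fun u => measurable_const.imp
    ((measurableSet_setOfPred.1 (hf u)).iff measurable_const)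

theorem measure_le_liminf_of_levelBall {μ : Measure PlaneTree} {μs : ℕ → Measure PlaneTree}
    (H : ∀ h t, μ (levelBall h t) ≤ liminf (fun n => μs n (levelBall h t)) atTop) (hU : IsOpen U) :
    μ U ≤ liminf (fun n => μs n U) atTop := by
  rw [← iUnion_preimage_truncations hU, (monotone_preimage_truncations U).measure_iUnion,
    iUnion_preimage_truncations hU]
  refine iSup_le fun h => ?_
  have hsum (ν : Measure PlaneTree) : ∑' c : truncations h U, ν (restrict h ⁻¹' {c.1}) =
      ν (restrict h ⁻¹' truncations h U) := by
    refine tsum_measure_preimage_singleton (countable_truncations h U) ?_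
    rintro _ ⟨⟨t, rfl⟩, _⟩
    exact measurableSet_levelBall h t
  have : Countable (truncations h U) := (countable_truncations h U).to_subtype
  calc μ (restrict h ⁻¹' truncations h U)
      = ∑' c : truncations h U, μ (restrict h ⁻¹' {c.1}) := (hsum μ).symm
    _ ≤ ∑' c : truncations h U, 1 * liminf (fun n => μs n (restrict h ⁻¹' {c.1})) atTop := by
        refine ENNReal.tsum_le_tsum fun ⟨_, ⟨t, ht⟩, _⟩ => ?_
        subst ht
        rw [one_mul]
        exact H h t
    _ ≤ liminf (fun n => ∑' c : truncations h U, 1 * μs n (restrict h ⁻¹' {c.1})) atTop :=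
        tsum_mul_liminf_le (fun _ => ENNReal.one_ne_top) _
    _ ≤ liminf (fun n => μs n U) atTop := by
        refine liminf_le_liminf (Eventually.of_forall fun n => ?_)
        simp only [one_mul, hsum]
        exact measure_mono fun t ht => mem_preimage_truncations.1 ht rfl

end Truncations

end PlaneTree

/-! ### Powers with extended natural exponents -/

/-- `x ^ m`, with the convention `x ^ ∞ = 0`, so that generating functions of possibly infinite
numbers of vertices only see the event that they are finite. -/
noncomputable def xpow (x : ℝ≥0∞) : ℕ∞ → ℝ≥0∞ :=
  ENat.recTopCoe 0 fun n => x ^ n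

section XPow

variable {x : ℝ≥0∞}

theorem xpow_coe (x : ℝ≥0∞) (n : ℕ) : xpow x n = x ^ n := rfl

theorem xpow_top (x : ℝ≥0∞) : xpow x ⊤ = 0 := rfl

theorem xpow_add (x : ℝ≥0∞) (a b : ℕ∞) : xpow x (a + b) = xpow x a * xpow x b := by
  induction a using ENat.recTopCoe with
  | top => rw [top_add, xpow_top, zero_mul]
  | coe a =>
    induction b using ENat.recTopCoe with
    | top => rw [add_top, xpow_top, mul_zero]
    | coe b => exact pow_add x a b

theorem xpow_sum {ι : Type*} (x : ℝ≥0∞) (s : Finset ι) (f : ι → ℕ∞) :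
    xpow x (∑ i ∈ s, f i) = ∏ i ∈ s, xpow x (f i) := by
  classical
  induction s using Finset.induction_on with
  | empty => exact pow_zero x
  | insert i s hi ih => rw [Finset.sum_insert hi, Finset.prod_insert hi, xpow_add, ih]

theorem xpow_le_one (hx : x ≤ 1) (m : ℕ∞) : xpow x m ≤ 1 := by
  induction m using ENat.recTopCoe with
  | top => exact zero_le_one
  | coe n => exact pow_le_one' hx n

theorem measurable_xpow (x : ℝ≥0∞) : Measurable (xpow x) := measurable_of_countable _

variable {Ω : Type*} [MeasurableSpace Ω] {P : Measure Ω} {f : Ω → ℕ∞}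

theorem tsum_ite_eq_xpow (x : ℝ≥0∞) (m : ℕ∞) :
    ∑' n : ℕ, (if m = n then x ^ n else 0) = xpow x m := by
  induction m using ENat.recTopCoe with
  | top => simp only [ENat.top_ne_natCast, if_false, tsum_zero, xpow_top]
  | coe m => simp only [Nat.cast_inj, tsum_ite_eq', xpow_coe]

theorem lintegral_xpow (P : Measure Ω) (hf : Measurable f) (x : ℝ≥0∞) :
    ∫⁻ ω, xpow x (f ω) ∂P = ∑' n : ℕ, P {ω | f ω = n} * x ^ n := by
  have hm (n : ℕ) : MeasurableSet {ω | f ω = n} := hf (measurableSet_singleton _)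
  simp only [← tsum_ite_eq_xpow]
  rw [lintegral_tsum fun n => (Measurable.ite (hm n) measurable_const
    measurable_const).aemeasurable]
  refine tsum_congr fun n => ?_
  rw [mul_comm, ← lintegral_indicator_const (hm n)]
  simp only [Set.indicator_apply, Set.mem_ofPred_eq]

theorem lintegral_xpow_le_one [IsProbabilityMeasure P] (hx : x ≤ 1) (f : Ω → ℕ∞) :
    ∫⁻ ω, xpow x (f ω) ∂P ≤ 1 :=
  (lintegral_mono fun _ => xpow_le_one hx _).trans_eq (by rw [lintegral_one, measure_univ])

end XPow

/-! ### Generating functions of Galton–Watson trees -/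

section GaltonWatson

variable {Ω : Type*} [MeasurableSpace Ω] {p : PMF ℕ} {τ : Ω → PlaneTree} {P : Measure Ω}

/-- The generating function of the number of leaves. -/
noncomputable def leafGen (τ : Ω → PlaneTree) (P : Measure Ω) (x : ℝ≥0∞) : ℝ≥0∞ :=
  ∫⁻ ω, xpow x (τ ω).numLeaves ∂P

/-- The generating function of the number of vertices. -/
noncomputable def sizeGen (τ : Ω → PlaneTree) (P : Measure Ω) (x : ℝ≥0∞) : ℝ≥0∞ :=
  ∫⁻ ω, xpow x (τ ω).size ∂P

theorem prod_indicator_levelBall {s t : PlaneTree} (hst : s.outdegree [] = t.outdegree [])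
    (h : ℕ) (f : PlaneTree → ℝ≥0∞) :
    ∏ i : Fin (t.outdegree []), (levelBall h (subtree i t)).indicator f (subtree i s) =
      (levelBall (h + 1) t).indicator
        (fun s => ∏ i : Fin (t.outdegree []), f (subtree i s)) s := by
  by_cases hs : s ∈ levelBall (h + 1) t
  · rw [Set.indicator_of_mem hs]
    exact Finset.prod_congr rfl fun i _ =>
      Set.indicator_of_mem (mem_levelBall.2 (restrict_subtree hs i)) _
  · rw [Set.indicator_of_notMem hs]
    rw [mem_levelBall, restrict_succ_eq_iff, not_and, not_forall] at hs
    obtain ⟨i, hi⟩ := hs hst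
    exact Finset.prod_eq_zero (Finset.mem_univ i)
      (Set.indicator_of_notMem (mt mem_levelBall.1 hi) _)

theorem xpow_numLeaves {t : PlaneTree} {n : ℕ} (ht : t.outdegree [] = n) (x : ℝ≥0∞) :
    xpow x t.numLeaves =
      x ^ (if n = 0 then 1 else 0) * ∏ i : Fin n, xpow x (subtree i t).numLeaves := by
  subst ht
  rw [numLeaves_eq, xpow_add, xpow_coe, xpow_sum]

theorem measurable_xpow_numLeaves (x : ℝ≥0∞) :
    Measurable fun t : PlaneTree => xpow x t.numLeaves :=
  (measurable_xpow x).comp measurable_numLeaves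

namespace IsGaltonWatsonTree

theorem measurableSet_outdegree (hτ : IsGaltonWatsonTree p τ P) (n : ℕ) :
    MeasurableSet {ω | (τ ω).outdegree [] = n} :=
  measurable_outdegree_nil.comp hτ.measurable (measurableSet_singleton n)

theorem lintegral_eq_tsum (hτ : IsGaltonWatsonTree p τ P) (f : Ω → ℝ≥0∞) :
    ∫⁻ ω, f ω ∂P = ∑' n, ∫⁻ ω in {ω | (τ ω).outdegree [] = n}, f ω ∂P := by
  have hU : ⋃ n, {ω | (τ ω).outdegree [] = n} = Set.univ :=
    Set.eq_univ_of_forall fun ω => Set.mem_iUnion.2 ⟨_, rfl⟩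
  rw [← lintegral_iUnion hτ.measurableSet_outdegree (pairwise_disjoint_fiber _), hU,
    Measure.restrict_univ]

variable [IsProbabilityMeasure P]

theorem setLIntegral_prod_subtree (hτ : IsGaltonWatsonTree p τ P) {n : ℕ}
    {f : Fin n → PlaneTree → ℝ≥0∞} (hf : ∀ i, Measurable (f i)) :
    ∫⁻ ω in {ω | (τ ω).outdegree [] = n}, ∏ i, f i (subtree i (τ ω)) ∂P =
      p n * ∏ i, ∫⁻ ω, f i (τ ω) ∂P := by
  rw [← hτ.root_law n]
  set A := {ω | (τ ω).outdegree [] = n}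
  rcases Nat.eq_zero_or_pos n with rfl | hn
  · simp only [Finset.univ_eq_empty, Finset.prod_empty, setLIntegral_one, mul_one, A]
  by_cases hPA : P A = 0
  · rw [hPA, zero_mul, Measure.restrict_eq_zero.2 hPA, lintegral_zero_measure]
  obtain ⟨hind, hlaw⟩ := hτ.branching n hn hPA
  have hmeas (i : Fin n) : Measurable fun ω => subtree i (τ ω) :=
    (measurable_subtree i).comp hτ.measurable
  have hcond : ∫⁻ ω, ∏ i, f i (subtree i (τ ω)) ∂P[|A] = ∏ i, ∫⁻ ω, f i (τ ω) ∂P := by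
    rw [lintegral_prod_eq_prod_lintegral_of_indepFun Finset.univ
      (fun (i : Fin n) ω => f i (subtree i (τ ω))) (hind.comp f hf)
      fun i => (hf i).comp (hmeas i)]
    refine Finset.prod_congr rfl fun i _ => ?_
    rw [← lintegral_map (hf i) (hmeas i), (hlaw i).map_eq, lintegral_map (hf i) hτ.measurable]
  rw [← hcond, ProbabilityTheory.cond, lintegral_smul_measure, smul_eq_mul, ← mul_assoc,
    ENNReal.mul_inv_cancel hPA (measure_ne_top P A), one_mul]

theorem setLIntegral_mul_prod_subtree (hτ : IsGaltonWatsonTree p τ P) {n : ℕ}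
    {f : Fin n → PlaneTree → ℝ≥0∞} (hf : ∀ i, Measurable (f i)) (c : ℝ≥0∞) :
    ∫⁻ ω in {ω | (τ ω).outdegree [] = n}, c * ∏ i, f i (subtree i (τ ω)) ∂P =
      c * (p n * ∏ i, ∫⁻ ω, f i (τ ω) ∂P) := by
  rw [lintegral_const_mul, hτ.setLIntegral_prod_subtree hf]
  exact Finset.measurable_fun_prod _ fun i _ =>
    (hf i).comp ((measurable_subtree i).comp hτ.measurable)

theorem sizeGen_eq (hτ : IsGaltonWatsonTree p τ P) (x : ℝ≥0∞) :
    sizeGen τ P x = x * pgf p (sizeGen τ P x) := by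
  have hx : Measurable fun t : PlaneTree => xpow x t.size :=
    (measurable_xpow x).comp measurable_size
  nth_rewrite 1 [sizeGen]
  rw [hτ.lintegral_eq_tsum, pgf, ← ENNReal.tsum_mul_left]
  refine tsum_congr fun n => ?_
  calc ∫⁻ ω in {ω | (τ ω).outdegree [] = n}, xpow x (τ ω).size ∂P
      = ∫⁻ ω in {ω | (τ ω).outdegree [] = n},
          x * ∏ i : Fin n, xpow x (subtree i (τ ω)).size ∂P := by
        refine setLIntegral_congr_fun (hτ.measurableSet_outdegree n) fun ω hω => ?_
        obtain rfl : (τ ω).outdegree [] = n := hω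
        rw [size_eq, xpow_add, xpow_sum, ← Nat.cast_one, xpow_coe, pow_one]
    _ = x * (p n * ∏ _i : Fin n, ∫⁻ ω, xpow x (τ ω).size ∂P) :=
        hτ.setLIntegral_mul_prod_subtree (fun _ => hx) x
    _ = x * (p n * sizeGen τ P x ^ n) := by
        rw [Finset.prod_const, Finset.card_univ, Fintype.card_fin, sizeGen]

theorem leafGen_eq (hτ : IsGaltonWatsonTree p τ P) (x : ℝ≥0∞) :
    leafGen τ P x + p 0 = pgf p (leafGen τ P x) + p 0 * x := by
  have hdeg (n : ℕ) : ∫⁻ ω in {ω | (τ ω).outdegree [] = n}, xpow x (τ ω).numLeaves ∂P =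
      x ^ (if n = 0 then 1 else 0) * (p n * leafGen τ P x ^ n) := by
    calc ∫⁻ ω in {ω | (τ ω).outdegree [] = n}, xpow x (τ ω).numLeaves ∂P
        = ∫⁻ ω in {ω | (τ ω).outdegree [] = n}, x ^ (if n = 0 then 1 else 0) *
            ∏ i : Fin n, xpow x (subtree i (τ ω)).numLeaves ∂P :=
          setLIntegral_congr_fun (hτ.measurableSet_outdegree n) fun ω hω => xpow_numLeaves hω x
      _ = x ^ (if n = 0 then 1 else 0) * (p n * ∏ _i : Fin n, leafGen τ P x) :=
          hτ.setLIntegral_mul_prod_subtree (fun _ => measurable_xpow_numLeaves x) _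
      _ = _ := by rw [Finset.prod_const, Finset.card_univ, Fintype.card_fin]
  have hgen : leafGen τ P x = x * p 0 + ∑' n, p (n + 1) * leafGen τ P x ^ (n + 1) := by
    nth_rewrite 1 [leafGen]
    rw [hτ.lintegral_eq_tsum, tsum_eq_zero_add_tsum_succ]
    simp only [hdeg, if_true, Nat.succ_ne_zero, if_false, pow_one, pow_zero, mul_one, one_mul]
  nth_rewrite 1 [hgen]
  rw [pgf, tsum_eq_zero_add_tsum_succ fun n => p n * leafGen τ P x ^ n]
  ring

theorem setLIntegral_levelBall_succ (hτ : IsGaltonWatsonTree p τ P) (h : ℕ) (t : PlaneTree)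
    (x : ℝ≥0∞) :
    ∫⁻ ω in τ ⁻¹' levelBall (h + 1) t, xpow x (τ ω).numLeaves ∂P =
      x ^ (if t.outdegree [] = 0 then 1 else 0) * (p (t.outdegree []) *
        ∏ i : Fin (t.outdegree []),
          ∫⁻ ω in τ ⁻¹' levelBall h (subtree i t), xpow x (τ ω).numLeaves ∂P) := by
  set k := t.outdegree [] with hk
  let f (i : Fin k) : PlaneTree → ℝ≥0∞ :=
    (levelBall h (subtree i t)).indicator fun s => xpow x s.numLeaves
  have hf (i : Fin k) : Measurable (f i) :=
    (measurable_xpow_numLeaves x).indicator (measurableSet_levelBall h _)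
  have hball (h : ℕ) (t : PlaneTree) : MeasurableSet (τ ⁻¹' levelBall h t) :=
    hτ.measurable (measurableSet_levelBall h t)
  have hsub : τ ⁻¹' levelBall (h + 1) t ⊆ {ω | (τ ω).outdegree [] = k} := fun ω hω =>
    (restrict_succ_eq_iff.1 (mem_levelBall.1 hω)).1
  calc ∫⁻ ω in τ ⁻¹' levelBall (h + 1) t, xpow x (τ ω).numLeaves ∂P
      = ∫⁻ ω in {ω | (τ ω).outdegree [] = k},
          (τ ⁻¹' levelBall (h + 1) t).indicator (fun ω => xpow x (τ ω).numLeaves) ω ∂P := by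
        rw [setLIntegral_indicator (hball _ t), Set.inter_eq_left.2 hsub]
    _ = ∫⁻ ω in {ω | (τ ω).outdegree [] = k},
          x ^ (if k = 0 then 1 else 0) * ∏ i, f i (subtree i (τ ω)) ∂P := by
        refine setLIntegral_congr_fun (hτ.measurableSet_outdegree k) fun ω hω => ?_
        dsimp only [f]
        rw [prod_indicator_levelBall (hω.trans hk)]
        by_cases hb : τ ω ∈ levelBall (h + 1) t
        · rw [Set.indicator_of_mem (Set.mem_preimage.2 hb), Set.indicator_of_mem hb,
            xpow_numLeaves hω]
        · rw [Set.indicator_of_notMem (by exact hb), Set.indicator_of_notMem hb, mul_zero]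
    _ = _ := by
        rw [hτ.setLIntegral_mul_prod_subtree hf]
        simp only [f, ← lintegral_indicator (hball _ _)]
        rfl

theorem setLIntegral_levelBall (hτ : IsGaltonWatsonTree p τ P) (h : ℕ) (t : PlaneTree)
    (x : ℝ≥0∞) :
    ∫⁻ ω in τ ⁻¹' levelBall h t, xpow x (τ ω).numLeaves ∂P =
      weight p h t * (x ^ numLeavesBelow h t * leafGen τ P x ^ (levelNodes h t).card) := by
  induction h generalizing t with
  | zero =>
    rw [show τ ⁻¹' levelBall 0 t = Set.univ from
      Set.eq_univ_of_forall fun ω => restrict_zero _ _, Measure.restrict_univ]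
    simp [weight, nodesBelow, levelNodes, numLeavesBelow, leafGen]
  | succ h ih =>
    rw [hτ.setLIntegral_levelBall_succ, weight_succ, numLeavesBelow_succ, card_levelNodes_succ]
    simp only [ih, Finset.prod_mul_distrib, Finset.prod_pow_eq_pow_sum, pow_add]
    ring

end IsGaltonWatsonTree

end GaltonWatson

/-! ### Kesten's tree -/

section OfDegrees

variable {κ : List ℕ → ℕ} {u : List ℕ}

theorem append_mem_ofDegrees_iff (hu : u ∈ (ofDegrees κ).nodes) (j : ℕ) :
    u ++ [j] ∈ (ofDegrees κ).nodes ↔ j < κ u := by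
  refine ⟨fun h => h u j (List.prefix_refl _), fun hj v i hv => ?_⟩
  rcases List.prefix_concat_iff.1 hv with h | h
  · obtain ⟨rfl, hi⟩ := List.append_inj' h rfl
    rwa [List.singleton_inj.1 hi]
  · exact hu v i h

theorem outdegree_ofDegrees (hu : u ∈ (ofDegrees κ).nodes) : (ofDegrees κ).outdegree u = κ u :=
  (outdegree_eq_iff hu _).2 (append_mem_ofDegrees_iff hu)

end OfDegrees

section Spine

variable {ω : List ℕ → ℕ × (ℕ × ℕ)} {u v : List ℕ} {m n : ℕ} {t : PlaneTree}

theorem length_specialNode (ω : List ℕ → ℕ × (ℕ × ℕ)) (n : ℕ) :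
    (specialNode ω n).length = n := by
  induction n with
  | zero => rfl
  | succ n ih => rw [specialNode, List.length_append, ih, List.length_singleton]

theorem specialNode_prefix (ω : List ℕ → ℕ × (ℕ × ℕ)) (hmn : m ≤ n) :
    specialNode ω m <+: specialNode ω n := by
  induction n, hmn using Nat.le_induction with
  | base => exact List.prefix_refl _
  | succ n _ ih => exact ih.trans (List.prefix_append _ _)

theorem eq_specialNode_of_prefix (hu : u <+: specialNode ω n) :
    u = specialNode ω u.length := by
  have hlen : u.length ≤ n := hu.length_le.trans_eq (length_specialNode ω n)
  exact (List.prefix_of_prefix_length_le hu (specialNode_prefix ω hlen)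
    (length_specialNode ω _).ge).eq_of_length (length_specialNode ω _).symm

theorem exists_eq_specialNode_iff (hu : u.length ≤ n) :
    (∃ m, u = specialNode ω m) ↔ u <+: specialNode ω n := by
  refine ⟨?_, fun h => ⟨_, eq_specialNode_of_prefix h⟩⟩
  rintro ⟨m, rfl⟩
  exact specialNode_prefix ω ((length_specialNode ω m).ge.trans hu)

theorem specialNode_mem_kestenOf (hω : ∀ u, (ω u).2.2 < (ω u).2.1) (n : ℕ) :
    specialNode ω n ∈ (kestenOf ω).nodes := by
  induction n with
  | zero => exact (kestenOf ω).root_mem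
  | succ n ih =>
    refine (append_mem_ofDegrees_iff ih _).2 ?_
    rw [if_pos ⟨n, rfl⟩]
    exact hω _

open Classical in
/-- The values of the data at `u` for which `u` has the same number of children as in `t`, when
`v` is the special vertex of its generation: if `u` is an ancestor of `v`, the rank of its special
child is moreover the one that leads to `v`. -/
noncomputable def spineConstraint (t : PlaneTree) (v u : List ℕ) : Set (ℕ × (ℕ × ℕ)) :=
  if u <+: v then Set.univ ×ˢ {(t.outdegree u, v.getD u.length 0)}
  else {t.outdegree u} ×ˢ Set.univ

theorem mem_spineConstraint (e : restrict n (kestenOf ω) = restrict n t)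
    (hu : u ∈ nodesBelow n t) : ω u ∈ spineConstraint t (specialNode ω n) u := by
  classical
  obtain ⟨hut, hun⟩ := mem_nodesBelow.1 hu
  have hdeg : t.outdegree u = if u <+: specialNode ω n then (ω u).2.1 else (ω u).1 := by
    rw [← outdegree_congr e hun, kestenOf,
      outdegree_ofDegrees ((restrict_eq_iff.1 e u hun.le).2 hut)]
    simp only [exists_eq_specialNode_iff hun.le]
  rw [spineConstraint]
  split_ifs at hdeg ⊢ with hspine
  · obtain ⟨w, hw⟩ : u ++ [(ω u).2.2] <+: specialNode ω n := by
      have h := specialNode_prefix ω (Nat.succ_le_of_lt hun)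
      rwa [specialNode, ← eq_specialNode_of_prefix hspine] at h
    refine ⟨trivial, Prod.ext hdeg.symm ?_⟩
    rw [← hw]
    simp
  · exact ⟨hdeg.symm, trivial⟩

theorem measurableSet_specialNode_eq (n : ℕ) (v : List ℕ) :
    MeasurableSet {ω : List ℕ → ℕ × (ℕ × ℕ) | v = specialNode ω n} := by
  induction n generalizing v with
  | zero => exact MeasurableSet.const (v = [])
  | succ n ih =>
    have hunion : {ω : List ℕ → ℕ × (ℕ × ℕ) | v = specialNode ω (n + 1)} =
        ⋃ w : List ℕ, {ω | w = specialNode ω n} ∩ {ω | v = w ++ [(ω w).2.2]} := by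
      ext ω
      simp [specialNode]
    rw [hunion]
    refine .iUnion fun w => (ih w).inter ?_
    have hw : Measurable fun ω : List ℕ → ℕ × (ℕ × ℕ) => ω w := measurable_pi_apply w
    exact hw (MeasurableSet.of_discrete (s := {x | v = w ++ [x.2.2]}))

theorem measurable_kestenOf : Measurable kestenOf := by
  classical
  refine measurable_of_measurableSet_mem fun u => ?_
  have hspecial (v : List ℕ) :
      MeasurableSet {ω : List ℕ → ℕ × (ℕ × ℕ) | ∃ n, v = specialNode ω n} := by
    rw [Set.ofPred_exists]
    exact .iUnion fun n => measurableSet_specialNode_eq n v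
  have hdeg (v : List ℕ) : Measurable fun ω : List ℕ → ℕ × (ℕ × ℕ) =>
      if ∃ n, v = specialNode ω n then (ω v).2.1 else (ω v).1 :=
    .ite (hspecial v) (measurable_pi_apply v).snd.fst (measurable_pi_apply v).fst
  have hnodes : {ω | u ∈ (kestenOf ω).nodes} = ⋂ v : List ℕ, ⋂ i : ℕ, ⋂ _ : v ++ [i] <+: u,
      {ω | i < if ∃ n, v = specialNode ω n then (ω v).2.1 else (ω v).1} := by
    ext ω
    simp only [Set.mem_iInter]
    rfl
  rw [hnodes]
  exact .iInter fun v => .iInter fun i => .iInter fun _ =>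
    hdeg v (MeasurableSet.of_discrete (s := Set.Ioi i))

end Spine

section KestenLaw

variable {p : PMF ℕ} {n : ℕ} {t : PlaneTree} {u v : List ℕ}

/-- Size-biasing and the uniform choice of the special child compensate: `k p(k) * k⁻¹ = p(k)`. -/
theorem specialLaw_apply (h : NonDegenerate p) (hc : IsCritical p) {k i : ℕ} (hik : i < k) :
    specialLaw p h hc.mean_ne_top (k, i) = p k := by
  have hk : (k : ℝ≥0∞) ≠ 0 := Nat.cast_ne_zero.2 hik.ne_bot
  have hrank : ((PMF.uniformOfFinset (Finset.range (k - 1 + 1)) (by simp)).map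
      fun j => (k, j)) (k, i) = (k : ℝ≥0∞)⁻¹ := by
    rw [PMF.map_apply, tsum_eq_single i, if_pos rfl, PMF.uniformOfFinset_apply, Finset.card_range,
      Nat.sub_add_cancel (Nat.one_le_of_lt hik), if_pos (Finset.mem_range.2 hik)]
    exact fun j hj => if_neg fun e => hj (Prod.ext_iff.1 e).2.symm
  have hother (k' : ℕ) (hk' : k' ≠ k) : ((PMF.uniformOfFinset (Finset.range (k' - 1 + 1))
      (by simp)).map fun j => (k', j)) (k, i) = 0 := by
    rw [PMF.map_apply, ENNReal.tsum_eq_zero]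
    exact fun j => if_neg fun e => hk' (Prod.ext_iff.1 e).1.symm
  have hbiased : sizeBiased p h hc.mean_ne_top k = k * p k := by
    change (k : ℝ≥0∞) * p k / mean p = _
    rw [show mean p = 1 from hc, div_one]
  rw [specialLaw, PMF.bind_apply,
    tsum_eq_single k fun k' hk' => by rw [hother k' hk', mul_zero], hrank, hbiased,
    mul_right_comm, ENNReal.mul_inv_cancel hk (ENNReal.natCast_ne_top k), one_mul]

theorem support_specialLaw_subset (h : NonDegenerate p) (hm : mean p ≠ ∞) :
    (specialLaw p h hm).support ⊆ {x | x.2 < x.1} := by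
  intro x hx
  obtain ⟨k, hk, hx⟩ := (PMF.mem_support_bind_iff _ _ _).1 hx
  obtain ⟨j, hj, rfl⟩ := (PMF.mem_support_map_iff _ _ _).1 hx
  have hk0 : k ≠ 0 := by
    rintro rfl
    refine (PMF.mem_support_iff _ _).1 hk ?_
    change ((0 : ℕ) : ℝ≥0∞) * p 0 / mean p = 0
    rw [Nat.cast_zero, zero_mul, ENNReal.zero_div]
  rw [PMF.mem_support_uniformOfFinset_iff, Finset.mem_range,
    Nat.sub_add_cancel (Nat.one_le_iff_ne_zero.2 hk0)] at hj
  exact hj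

theorem prod_measure_spineConstraint (h : NonDegenerate p) (hc : IsCritical p)
    (hv : v ∈ levelNodes n t) (hu : u ∈ nodesBelow n t) :
    (p.toMeasure.prod (specialLaw p h hc.mean_ne_top).toMeasure) (spineConstraint t v u) =
      p (t.outdegree u) := by
  obtain ⟨hvt, hvn⟩ := mem_levelNodes.1 hv
  obtain ⟨hut, hun⟩ := mem_nodesBelow.1 hu
  rw [spineConstraint]
  split_ifs with huv
  · have hrank : v.getD u.length 0 < t.outdegree u := by
      obtain ⟨_ | ⟨i, w⟩, rfl⟩ := huv
      · rw [List.append_nil] at hvn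
        exact absurd hvn hun.ne
      · rw [List.getD_append_right _ _ _ _ le_rfl, Nat.sub_self, List.getD_cons_zero,
          ← append_mem_iff hut]
        exact mem_of_prefix ⟨w, List.append_cons u i w ▸ rfl⟩ hvt
    rw [Measure.prod_prod, measure_univ, one_mul,
      PMF.toMeasure_apply_singleton _ _ (measurableSet_singleton _), specialLaw_apply h hc hrank]
  · rw [Measure.prod_prod, measure_univ, mul_one,
      PMF.toMeasure_apply_singleton _ _ (measurableSet_singleton _)]

theorem kestenData_pi_spineConstraint (h : NonDegenerate p) (hc : IsCritical p)
    (hv : v ∈ levelNodes n t) :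
    kestenData p h hc.mean_ne_top (Set.pi (nodesBelow n t) (spineConstraint t v)) =
      weight p n t := by
  rw [kestenData, Measure.infinitePi_pi _ fun _ _ => .of_discrete, weight]
  exact Finset.prod_congr rfl fun u hu => prod_measure_spineConstraint h hc hv hu

theorem ae_kestenData_rank_lt (h : NonDegenerate p) (hm : mean p ≠ ∞) :
    ∀ᵐ ω ∂kestenData p h hm, ∀ u, (ω u).2.2 < (ω u).2.1 := by
  have hspecial : ∀ᵐ y ∂(specialLaw p h hm).toMeasure, y.2 < y.1 := by
    rw [ae_iff, PMF.toMeasure_apply_eq_zero_iff _ .of_discrete]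
    exact Set.disjoint_left.2 fun y hy hy' => hy' (support_specialLaw_subset h hm hy)
  have hpair : ∀ᵐ x ∂p.toMeasure.prod (specialLaw p h hm).toMeasure, x.2.2 < x.2.1 :=
    Measure.quasiMeasurePreserving_snd.ae hspecial
  exact ae_all_iff.2 fun u => (measurePreserving_eval_infinitePi
    (fun _ : List ℕ => p.toMeasure.prod (specialLaw p h hm).toMeasure) u).quasiMeasurePreserving.ae
    hpair

theorem kestenLaw_levelBall_le (h : NonDegenerate p) (hc : IsCritical p) (n : ℕ)
    (t : PlaneTree) :
    kestenLaw p h hc.mean_ne_top (levelBall n t) ≤ (levelNodes n t).card * weight p n t := by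
  rw [kestenLaw, Measure.map_apply measurable_kestenOf (measurableSet_levelBall n t)]
  calc kestenData p h hc.mean_ne_top (kestenOf ⁻¹' levelBall n t)
      ≤ kestenData p h hc.mean_ne_top (⋃ v ∈ levelNodes n t,
          Set.pi (nodesBelow n t) (spineConstraint t v)) := by
        refine measure_mono_ae ?_
        filter_upwards [ae_kestenData_rank_lt h hc.mean_ne_top] with ω hω
        intro (e : restrict n (kestenOf ω) = restrict n t)
        have hlen := length_specialNode ω n
        have hmem : specialNode ω n ∈ levelNodes n t := mem_levelNodes.2
          ⟨(restrict_eq_iff.1 e _ hlen.le).1 (specialNode_mem_kestenOf hω n), hlen⟩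
        exact Set.mem_biUnion hmem fun u hu => mem_spineConstraint e hu
    _ ≤ ∑ v ∈ levelNodes n t, kestenData p h hc.mean_ne_top
          (Set.pi (nodesBelow n t) (spineConstraint t v)) := measure_biUnion_finset_le _ _
    _ = (levelNodes n t).card * weight p n t := by
        rw [Finset.sum_congr rfl fun v hv => kestenData_pi_spineConstraint h hc hv,
          Finset.sum_const, nsmul_eq_mul]

end KestenLaw

/-! ### The law of the number of leaves -/

section ENat

variable {Ω : Type*}

theorem pairwise_disjoint_eq_natCast (f : Ω → ℕ∞) :
    Pairwise (Function.onFun Disjoint fun n : ℕ => {ω | f ω = n}) :=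
  (pairwise_disjoint_fiber f).comp_of_injective Nat.cast_injective

variable [MeasurableSpace Ω] {P : Measure Ω} {f : Ω → ℕ∞}

theorem measurableSet_eq_natCast (hf : Measurable f) (n : ℕ) : MeasurableSet {ω | f ω = n} :=
  hf (measurableSet_singleton _)

theorem tsum_measure_eq_natCast_add_eq_top (P : Measure Ω) (hf : Measurable f) :
    ∑' n : ℕ, P {ω | f ω = n} + P {ω | f ω = ⊤} = P Set.univ := by
  have htop : {ω | f ω = ⊤} = (⋃ n : ℕ, {ω | f ω = n})ᶜ := by
    ext ω
    simp only [Set.mem_ofPred_eq, Set.mem_compl_iff, Set.mem_iUnion, eq_comm (a := f ω),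
      ← ENat.ne_top_iff_exists, not_not]
  rw [htop, ← measure_iUnion (pairwise_disjoint_eq_natCast f) (measurableSet_eq_natCast hf),
    measure_add_measure_compl (.iUnion (measurableSet_eq_natCast hf))]

theorem tsum_measure_eq_natCast_ne_top [IsFiniteMeasure P] (hf : Measurable f) :
    ∑' n : ℕ, P {ω | f ω = n} ≠ ∞ :=
  ne_top_of_le_ne_top (measure_ne_top P Set.univ)
    (tsum_measure_eq_natCast_add_eq_top P hf ▸ le_self_add)

theorem identDistrib_of_lintegral_xpow_eq {Ω' : Type*} [MeasurableSpace Ω'] {P' : Measure Ω'}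
    {f' : Ω' → ℕ∞} [IsProbabilityMeasure P] [IsProbabilityMeasure P'] (hf : Measurable f)
    (hf' : Measurable f') (h : ∀ x < 1, ∫⁻ ω, xpow x (f ω) ∂P = ∫⁻ ω, xpow x (f' ω) ∂P') :
    IdentDistrib f f' P P' := by
  have hfin (n : ℕ) : P {ω | f ω = n} = P' {ω | f' ω = n} := by
    refine coeff_eq_of_tsum_mul_pow_eq (tsum_measure_eq_natCast_ne_top hf)
      (tsum_measure_eq_natCast_ne_top hf') (fun x hx => ?_) n
    rw [← lintegral_xpow P hf, ← lintegral_xpow P' hf', h x hx]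
  have htop : P {ω | f ω = ⊤} = P' {ω | f' ω = ⊤} := by
    have htotal := (tsum_measure_eq_natCast_add_eq_top P hf).trans
      (measure_univ.trans (measure_univ (μ := P')).symm)
    rw [← tsum_measure_eq_natCast_add_eq_top P' hf', tsum_congr hfin] at htotal
    exact (ENNReal.add_right_inj (tsum_measure_eq_natCast_ne_top hf')).1 htotal
  refine ⟨hf.aemeasurable, hf'.aemeasurable, Measure.ext_of_singleton fun m => ?_⟩
  rw [Measure.map_apply hf (measurableSet_singleton m),
    Measure.map_apply hf' (measurableSet_singleton m)]
  induction m using ENat.recTopCoe with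
  | top => exact htop
  | coe n => exact hfin n

end ENat

section GaltonWatson

variable {Ω : Type*} [MeasurableSpace Ω] {p : PMF ℕ} {τ : Ω → PlaneTree} {P : Measure Ω}

theorem IsGaltonWatsonTree.measurable_numLeaves (hτ : IsGaltonWatsonTree p τ P) :
    Measurable fun ω => (τ ω).numLeaves :=
  PlaneTree.measurable_numLeaves.comp hτ.measurable

variable [IsProbabilityMeasure P]

theorem IsGaltonWatsonTree.tsum_measure_numLeaves_eq (hτ : IsGaltonWatsonTree p τ P)
    (hp : NonDegenerate p) (hc : IsCritical p) : ∑' n : ℕ, P {ω | (τ ω).numLeaves = n} = 1 := by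
  have hgen : leafGen τ P 1 = 1 := by
    have heq := hτ.leafGen_eq 1
    rw [mul_one] at heq
    refine eq_of_add_eq_pgf_add hp hc (lintegral_xpow_le_one le_rfl _) le_rfl (p.apply_ne_top 0)
      heq ?_
    rw [pgf_one]
  simpa only [leafGen, lintegral_xpow P hτ.measurable_numLeaves, one_pow, mul_one] using hgen

theorem IsGaltonWatsonTree.ae_numLeaves_ne_top (hτ : IsGaltonWatsonTree p τ P)
    (hp : NonDegenerate p) (hc : IsCritical p) : ∀ᵐ ω ∂P, (τ ω).numLeaves ≠ ⊤ := by
  have htotal := tsum_measure_eq_natCast_add_eq_top P hτ.measurable_numLeaves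
  rw [hτ.tsum_measure_numLeaves_eq hp hc, measure_univ] at htotal
  have hzero := (ENNReal.add_right_inj ENNReal.one_ne_top).1 (htotal.trans (add_zero 1).symm)
  simpa only [ae_iff, not_not] using hzero

/-- The law of the number of leaves of a critical Galton–Watson tree. -/
noncomputable def leafLaw (hτ : IsGaltonWatsonTree p τ P) (hp : NonDegenerate p)
    (hc : IsCritical p) : PMF ℕ :=
  ⟨fun n => P {ω | (τ ω).numLeaves = n},
    ENNReal.summable.hasSum_iff.2 (hτ.tsum_measure_numLeaves_eq hp hc)⟩

theorem pgf_leafLaw (hτ : IsGaltonWatsonTree p τ P) (hp : NonDegenerate p) (hc : IsCritical p)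
    (x : ℝ≥0∞) : pgf (leafLaw hτ hp hc) x = leafGen τ P x :=
  (lintegral_xpow P hτ.measurable_numLeaves x).symm

theorem isTotalProgeny_leafLaw (hτ : IsGaltonWatsonTree p τ P) (hp : NonDegenerate p)
    (hc : IsCritical p) : IsTotalProgeny (leafOffspring p hp) (leafLaw hτ hp hc) := by
  intro x hx
  rw [pgf_leafLaw]
  set F := leafGen τ P x
  set ψ := pgf (leafOffspring p hp) F
  have hF : F ≤ 1 := lintegral_xpow_le_one hx.le _
  have hfin : ψ * pgf p F ≠ ∞ := ENNReal.mul_ne_top (pgf_ne_top _ hF) (pgf_ne_top _ hF)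
  have hcancel : p 0 * F = p 0 * (x * ψ) := by
    have h := pgf_leafOffspring_mul_add hp F
    rw [hτ.leafGen_eq x, mul_add, add_comm, ENNReal.add_left_inj hfin] at h
    rw [← h]
    ring
  exact (ENNReal.mul_right_inj hp.zero_pos.ne' (p.apply_ne_top 0)).1 hcancel

section Size

variable {Ω₀ : Type*} [MeasurableSpace Ω₀] {P₀ : Measure Ω₀} [IsProbabilityMeasure P₀]
  {τ₀ : Ω₀ → PlaneTree}

theorem leafGen_eq_sizeGen (hτ : IsGaltonWatsonTree p τ P) (hp : NonDegenerate p)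
    (hc : IsCritical p) (hτ₀ : IsGaltonWatsonTree (leafOffspring p hp) τ₀ P₀) {x : ℝ≥0∞}
    (hx : x ≤ 1) : leafGen τ P x = sizeGen τ₀ P₀ x := by
  have hS := hτ₀.sizeGen_eq x
  have hS1 : sizeGen τ₀ P₀ x ≤ 1 := lintegral_xpow_le_one hx _
  refine eq_of_add_eq_pgf_add hp hc (lintegral_xpow_le_one hx _) hS1
    (ENNReal.mul_ne_top (p.apply_ne_top 0) (ne_top_of_le_ne_top ENNReal.one_ne_top hx))
    (hτ.leafGen_eq x) ?_
  set S := sizeGen τ₀ P₀ x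
  have hψ : pgf (leafOffspring p hp) S ≠ 0 :=
    ((nonDegenerate_leafOffspring hp hc).zero_pos.trans_le (apply_zero_le_pgf _ S)).ne'
  refine (ENNReal.mul_right_inj hψ (pgf_ne_top _ hS1)).1 ?_
  rw [pgf_leafOffspring_mul_add hp S]
  nth_rewrite 1 [hS]
  ring

theorem identDistrib_numLeaves_size (hτ : IsGaltonWatsonTree p τ P) (hp : NonDegenerate p)
    (hc : IsCritical p) (hτ₀ : IsGaltonWatsonTree (leafOffspring p hp) τ₀ P₀) :
    IdentDistrib (fun ω => (τ ω).numLeaves) (fun ω => (τ₀ ω).size) P P₀ :=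
  identDistrib_of_lintegral_xpow_eq hτ.measurable_numLeaves (measurable_size.comp hτ₀.measurable)
    fun _ hx => leafGen_eq_sizeGen hτ hp hc hτ₀ hx.le

end Size

end GaltonWatson

/-! ### Conditioning on the number of leaves -/

/-- The event that the number of leaves belongs to `n + D`. -/
def leafEvent {Ω : Type*} (τ : Ω → PlaneTree) (D : Set ℕ) (n : ℕ) : Set Ω :=
  {ω | ∃ k : ℕ, (n ≤ k ∧ k - n ∈ D) ∧ (τ ω).numLeaves = k}

theorem leafEvent_Iio {Ω : Type*} (τ : Ω → PlaneTree) (d n : ℕ) :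
    leafEvent τ (Set.Iio d) n =
      {ω | (n : ℕ∞) ≤ (τ ω).numLeaves ∧ (τ ω).numLeaves < ((n + d : ℕ) : ℕ∞)} := by
  ext ω
  constructor
  · rintro ⟨k, ⟨hnk, hk⟩, hω⟩
    rw [Set.mem_Iio] at hk
    rw [Set.mem_ofPred_eq, hω, Nat.cast_le, Nat.cast_lt]
    omega
  · rintro ⟨hn, hd⟩
    obtain ⟨k, hk⟩ := ENat.ne_top_iff_exists.1 hd.ne_top
    rw [← hk, Nat.cast_le] at hn
    rw [← hk, Nat.cast_lt] at hd
    exact ⟨k, ⟨hn, by rw [Set.mem_Iio]; omega⟩, hk.symm⟩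

section GaltonWatson

variable {Ω : Type*} [MeasurableSpace Ω] {p : PMF ℕ} {τ : Ω → PlaneTree} {P : Measure Ω}
  [IsProbabilityMeasure P]

theorem leafEvent_univ_ae_eq (hτ : IsGaltonWatsonTree p τ P) (hp : NonDegenerate p)
    (hc : IsCritical p) (n : ℕ) :
    leafEvent τ Set.univ n =ᵐ[P] {ω | (n : ℕ∞) ≤ (τ ω).numLeaves} := by
  filter_upwards [hτ.ae_numLeaves_ne_top hp hc] with ω hω
  obtain ⟨k, hk⟩ := ENat.ne_top_iff_exists.1 hω
  refine propext (?_ : (∃ j : ℕ, (n ≤ j ∧ j - n ∈ Set.univ) ∧ (τ ω).numLeaves = j) ↔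
    (n : ℕ∞) ≤ (τ ω).numLeaves)
  rw [← hk]
  simp only [Set.mem_univ, and_true, Nat.cast_inj, exists_eq_right', Nat.cast_le]

theorem cond_leafEvent_univ (hτ : IsGaltonWatsonTree p τ P) (hp : NonDegenerate p)
    (hc : IsCritical p) (n : ℕ) :
    P[|leafEvent τ Set.univ n] = P[|{ω | (n : ℕ∞) ≤ (τ ω).numLeaves}] := by
  have hae := leafEvent_univ_ae_eq hτ hp hc n
  rw [ProbabilityTheory.cond, ProbabilityTheory.cond, measure_congr hae,
    Measure.restrict_congr_set hae]

theorem measurableSet_leafEvent (hτ : Measurable τ) (D : Set ℕ) (n : ℕ) :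
    MeasurableSet (leafEvent τ D n) :=
  (measurable_numLeaves.comp hτ) (MeasurableSet.of_discrete
    (s := {m : ℕ∞ | ∃ k : ℕ, (n ≤ k ∧ k - n ∈ D) ∧ m = k}))

theorem measure_leafEvent_eq_tsum (ν : Measure Ω) (hτ : Measurable τ) (D : Set ℕ) (n : ℕ) :
    ν (leafEvent τ D n) = ∑' k : ℕ, ν {ω | (τ ω).numLeaves = k} * window D n k := by
  have hunion : leafEvent τ D n =
      ⋃ k ∈ {k | n ≤ k ∧ k - n ∈ D}, {ω | (τ ω).numLeaves = k} := by
    ext ω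
    simp only [leafEvent, Set.mem_iUnion₂, Set.mem_ofPred_eq, exists_prop]
  have hL : Measurable fun ω => (τ ω).numLeaves := measurable_numLeaves.comp hτ
  rw [hunion, measure_biUnion (Set.to_countable _)
    ((pairwise_disjoint_eq_natCast _).set_pairwise _) fun k _ => measurableSet_eq_natCast hL k,
    tsum_subtype {k | n ≤ k ∧ k - n ∈ D} fun k : ℕ => ν {ω | (τ ω).numLeaves = k}]
  refine tsum_congr fun k => ?_
  classical rw [window, Set.indicator_apply, mul_ite, mul_one, mul_zero]
  rfl

theorem measure_leafEvent (hτ : IsGaltonWatsonTree p τ P) (hp : NonDegenerate p)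
    (hc : IsCritical p) (D : Set ℕ) (n : ℕ) :
    P (leafEvent τ D n) = windowMass (leafLaw hτ hp hc) D n :=
  measure_leafEvent_eq_tsum P hτ.measurable D n

/-- Given that `τ` coincides with `t` up to height `h`, the sub-trees above the vertices of height
`h` are independent copies of `τ`. -/
theorem measure_restrict_levelBall_numLeaves_eq (hτ : IsGaltonWatsonTree p τ P)
    (hp : NonDegenerate p) (hc : IsCritical p) (h : ℕ) (t : PlaneTree) (k : ℕ) :
    P.restrict (τ ⁻¹' levelBall h t) {ω | (τ ω).numLeaves = k} =
      weight p h t * (sumLaw (leafLaw hτ hp hc) (levelNodes h t).card).map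
        (fun m => numLeavesBelow h t + m) k := by
  refine coeff_eq_of_tsum_mul_pow_eq (b := fun k => weight p h t *
    (sumLaw (leafLaw hτ hp hc) (levelNodes h t).card).map (fun m => numLeavesBelow h t + m) k)
    (tsum_measure_eq_natCast_ne_top hτ.measurable_numLeaves) ?_ (fun x _ => ?_) k
  · rw [ENNReal.tsum_mul_left, PMF.tsum_coe, mul_one]
    exact ne_top_of_le_ne_top ENNReal.one_ne_top (weight_le_one p h t)
  · rw [← lintegral_xpow _ hτ.measurable_numLeaves, hτ.setLIntegral_levelBall,
      ← pgf_leafLaw hτ hp hc, ← pgf_sumLaw]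
    simp only [mul_assoc, ENNReal.tsum_mul_left]
    rw [tsum_map_mul, pgf, ← ENNReal.tsum_mul_left]
    congr 1
    refine tsum_congr fun m => ?_
    rw [pow_add, mul_left_comm]

theorem measure_leafEvent_inter_levelBall (hτ : IsGaltonWatsonTree p τ P)
    (hp : NonDegenerate p) (hc : IsCritical p) (D : Set ℕ) (h : ℕ) (t : PlaneTree) {n : ℕ}
    (hn : numLeavesBelow h t ≤ n) :
    P (leafEvent τ D n ∩ τ ⁻¹' levelBall h t) =
      weight p h t * windowMass (sumLaw (leafLaw hτ hp hc) (levelNodes h t).card) D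
        (n - numLeavesBelow h t) := by
  rw [← Measure.restrict_apply (measurableSet_leafEvent hτ.measurable D n),
    measure_leafEvent_eq_tsum _ hτ.measurable]
  simp only [measure_restrict_levelBall_numLeaves_eq hτ hp hc, mul_assoc]
  rw [ENNReal.tsum_mul_left, tsum_map_mul, windowMass_sub hn]

/-! ### Convergence in distribution -/

theorem kestenLaw_levelBall_le_liminf (hτ : IsGaltonWatsonTree p τ P) (hp : NonDegenerate p)
    (hc : IsCritical p) {D : Set ℕ} (hD : LongTailed (leafLaw hτ hp hc) D) (h : ℕ)
    (t : PlaneTree) :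
    kestenLaw p hp hc.mean_ne_top (levelBall h t) ≤
      liminf (fun n => (P[|leafEvent τ D n]).map τ (levelBall h t)) atTop := by
  set ℓ := numLeavesBelow h t
  set k := (levelNodes h t).card
  set q := leafLaw hτ hp hc
  have hcond (n : ℕ) (hn : ℓ ≤ n) : (P[|leafEvent τ D n]).map τ (levelBall h t) =
      weight p h t * (windowMass (sumLaw q k) D (n - ℓ) / windowMass q D n) := by
    rw [Measure.map_apply hτ.measurable (measurableSet_levelBall h t),
      cond_apply (measurableSet_leafEvent hτ.measurable D n),
      measure_leafEvent_inter_levelBall hτ hp hc D h t hn, measure_leafEvent hτ hp hc,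
      ENNReal.div_eq_inv_mul, mul_left_comm]
  calc kestenLaw p hp hc.mean_ne_top (levelBall h t)
      ≤ weight p h t * k := (kestenLaw_levelBall_le hp hc h t).trans_eq (mul_comm _ _)
    _ ≤ weight p h t *
          liminf (fun n => windowMass (sumLaw q k) D (n - ℓ) / windowMass q D n) atTop := by
        gcongr
        exact hD.le_liminf k ℓ
    _ = liminf (fun n =>
          weight p h t * (windowMass (sumLaw q k) D (n - ℓ) / windowMass q D n)) atTop :=
        (ENNReal.liminf_const_mul_of_ne_top
          (ne_top_of_le_ne_top ENNReal.one_ne_top (weight_le_one p h t))).symm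
    _ = _ := liminf_congr ((eventually_ge_atTop ℓ).mono fun n hn => (hcond n hn).symm)

theorem tendstoInDistribution_of_longTailed (hτ : IsGaltonWatsonTree p τ P)
    (hp : NonDegenerate p) (hc : IsCritical p) {Ω' : Type*} [MeasurableSpace Ω']
    {P' : Measure Ω'} [IsProbabilityMeasure P'] {τstar : Ω' → PlaneTree}
    (hτstar : HasLaw τstar (kestenLaw p hp hc.mean_ne_top) P') {D : Set ℕ}
    (hD : LongTailed (leafLaw hτ hp hc) D) {S : ℕ → Type*}
    [∀ n, MeasurableSpace (S n)] {Q : ∀ n, Measure (S n)} [∀ n, IsProbabilityMeasure (Q n)]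
    {T : ∀ n, S n → PlaneTree} (hT : ∀ n, Measurable (T n))
    (hQ : ∀ n, P (leafEvent τ D n) ≠ 0 → (Q n).map (T n) = (P[|leafEvent τ D n]).map τ) :
    TendstoInDistribution T atTop τstar Q P' := by
  refine ⟨fun n => (hT n).aemeasurable, hτstar.aemeasurable, ?_⟩
  refine tendsto_of_forall_isOpen_le_liminf' fun U hU => ?_
  have hlaw : ∀ᶠ n in atTop, (Q n).map (T n) = (P[|leafEvent τ D n]).map τ :=
    hD.eventually_ne_zero.mono fun n hn => hQ n (measure_leafEvent hτ hp hc D n ▸ hn)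
  calc P'.map τstar U = kestenLaw p hp hc.mean_ne_top U := by rw [hτstar.map_eq]
    _ ≤ liminf (fun n => (P[|leafEvent τ D n]).map τ U) atTop :=
        measure_le_liminf_of_levelBall (kestenLaw_levelBall_le_liminf hτ hp hc hD) hU
    _ = liminf (fun n => (Q n).map (T n) U) atTop :=
        liminf_congr (hlaw.mono fun n hn => by rw [hn])

end GaltonWatson

end RandomTree

theorem mainTheorem7
    (p : PMF ℕ) (hp : NonDegenerate p) (hcrit : IsCritical p)
    {Ω : Type*} [MeasurableSpace Ω] (P : Measure Ω) [IsProbabilityMeasure P]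
    (τ : Ω → PlaneTree) (hτ : IsGaltonWatsonTree p τ P)
    {Ω' : Type*} [MeasurableSpace Ω'] (P' : Measure Ω') [IsProbabilityMeasure P']
    (τstar : Ω' → PlaneTree) (hτstar : HasLaw τstar (kestenLaw p hp hcrit.mean_ne_top) P') :
    -- the leaves of `τ` are distributed as the vertices of a critical Galton–Watson tree
    (NonDegenerate (leafOffspring p hp) ∧ IsCritical (leafOffspring p hp) ∧
      ∀ (Ω₀ : Type*) [MeasurableSpace Ω₀] (P₀ : Measure Ω₀) [IsProbabilityMeasure P₀]
        (τ₀ : Ω₀ → PlaneTree), IsGaltonWatsonTree (leafOffspring p hp) τ₀ P₀ →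
        IdentDistrib (fun ω => (τ ω).numLeaves) (fun ω => (τ₀ ω).size) P P₀) ∧
    -- conditioning on `L₀(τ) ∈ [n, n + d₀)`
    ((∀ᶠ n : ℕ in atTop, P {ω | (n : ℕ∞) ≤ (τ ω).numLeaves ∧
        (τ ω).numLeaves < ((n + period (leafOffspring p hp) : ℕ) : ℕ∞)} ≠ 0) ∧
      ∀ (S : ℕ → Type*) [∀ n, MeasurableSpace (S n)] (Q : ∀ n, Measure (S n))
        [∀ n, IsProbabilityMeasure (Q n)] (T : ∀ n, S n → PlaneTree),
        (∀ n, Measurable (T n)) →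
        (∀ n : ℕ, P {ω | (n : ℕ∞) ≤ (τ ω).numLeaves ∧
            (τ ω).numLeaves < ((n + period (leafOffspring p hp) : ℕ) : ℕ∞)} ≠ 0 →
          (Q n).map (T n) = (P[|{ω | (n : ℕ∞) ≤ (τ ω).numLeaves ∧
            (τ ω).numLeaves < ((n + period (leafOffspring p hp) : ℕ) : ℕ∞)}]).map τ) →
        TendstoInDistribution T atTop τstar Q P') ∧
    -- conditioning on `L₀(τ) ≥ n`
    ((∀ n : ℕ, P {ω | (n : ℕ∞) ≤ (τ ω).numLeaves} ≠ 0) ∧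
      ∀ (S : ℕ → Type*) [∀ n, MeasurableSpace (S n)] (Q : ∀ n, Measure (S n))
        [∀ n, IsProbabilityMeasure (Q n)] (T : ∀ n, S n → PlaneTree),
        (∀ n, Measurable (T n)) →
        (∀ n : ℕ, (Q n).map (T n) = (P[|{ω | (n : ℕ∞) ≤ (τ ω).numLeaves}]).map τ) →
        TendstoInDistribution T atTop τstar Q P') := by
  have hq := nonDegenerate_leafOffspring hp hcrit
  have hqcrit := isCritical_leafOffspring hp hcrit
  have hL := isTotalProgeny_leafLaw hτ hp hcrit
  refine ⟨⟨hq, hqcrit, fun Ω₀ _ P₀ _ τ₀ hτ₀ => identDistrib_numLeaves_size hτ hp hcrit hτ₀⟩,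
    ?_, fun n => ?_, fun S _ Q _ T hT hQ => ?_⟩
  · have hD := hL.longTailed_Iio hq hqcrit
    simp only [← leafEvent_Iio]
    constructor
    · simpa only [measure_leafEvent hτ hp hcrit] using hD.eventually_ne_zero
    · intro S _ Q _ T hT hQ
      exact tendstoInDistribution_of_longTailed hτ hp hcrit hτstar hD hT hQ
  · rw [← measure_congr (leafEvent_univ_ae_eq hτ hp hcrit n), measure_leafEvent hτ hp hcrit]
    exact hL.windowMass_univ_ne_zero hq n
  · refine tendstoInDistribution_of_longTailed hτ hp hcrit hτstar (hL.longTailed_univ hq) hT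
      fun n _ => ?_
    rw [cond_leafEvent_univ hτ hp hcrit, hQ n]
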